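/- **Proposition 4.1 (Loop-interlacements point process extension).** Fix $d\in\mathbb N$ and $\beta\in(0,\infty)$, and put $W_R=[-R,R]^d$ for $R\in\mathbb N=\{1,2,\dots\}$. *Paths.* For $k\in\mathbb N$ let $\mathcal C_k$ be the set of continuous functions $f\colon[0,k\beta]\to\mathbb R^d$ with the topology of uniform convergence, and write $\ell(f)=k$ for $f\in\mathcal C_k$. Let $\mathcal C=\bigcup_{k\in\mathbb N}\mathcal C_k$ be the disjoint union, with its Borel $\sigma$-field. A *loop* of length $k$ is an $f\in\mathcal C_k$ with $f(0)=f(k\beta)$, where loops that are cyclic time-shifts of each other by an integer multiple of $\beta$ are identified; $\mathcal C^{\circlearrowleft}$ is the space of loops, with the quotient $\sigma$-field. An *interlacement* is a continuous function $g\colon\mathbb R\to\mathbb R^d$ such that every compact set contains $g(k\beta)$ for only finitely many $k\in\mathbb Z$, where time-shifts by integer multiples of $\beta$ are identified; $\mathcal C_\infty$ is the set of interlacements. The values at integer multiples of $\beta$ are called the *particles*. *Shreds.* For $W\subset\mathbb R^d$, a *$W$-shred* is an $s\in\mathcal C_n$ with $n\ge2$, $s(0)\notin W$, $s(\beta),\dots,s((n-1)\beta)\in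 W$ and $s(n\beta)\notin W$. The $W$-shreds of an interlacement, of a loop (extended periodically; initial times are counted modulo the period), or of a $W'$-shred with $W\subset W'$, are all the pieces of it on intervals $[a\beta,(a+n)\beta]$ with $a\in\mathbb Z$, shifted in time to $[0,n\beta]$, that are $W$-shreds, counted with multiplicity. A loop with all its particles in $W$ has no $W$-shreds. *Configurations.* A marked loop is a pair $(x,f)$ with $x\in\mathbb R^d$, $f\in\mathcal C^{\circlearrowleft}$ and $f(0)=x$ for some representative of $f$. Let $\mathcal L_W$ be the set of finite simple point measures on the marked loops $(x,f)$ such that all particles of $f$ lie in $W$, and $\mathcal S_W$ the set of finite simple point measures on the $W$-shreds; $\mathcal L_W\times\mathcal S_W$ carries the $\sigma$-field generated by the evaluations of the two point measures at measurable sets. Let $\mathcal L$ be the set of simple point measures on the marked loops with only finitely many loops starting (i.e., with $x$) in any bounded set, and $\mathcal S$ the set of simple point measures on $\mathcal C_\infty$ with only finitely many particles in any compact set. *Projections.* For $(\omega,\varpi)\in\mathcal L\times\mathcal S$ let $\Pi_W(\omega,\varpi)$ be the pair consisting of the point measure of all the loops of $\omega$ that have all their particles in $W$, and the point measure (with multiplicities)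 of all the $W$-shreds of the other loops of $\omega$ and of the interlacements of $\varpi$. For $W\subset W'$, the projection $\Pi_{W'\to W}$ is defined on $\mathcal L_{W'}\times\mathcal S_{W'}$ in the same way, with the $W'$-shreds in place of the interlacements. Let $\mathcal L\times\mathcal S$ carry the $\sigma$-field generated by the maps $\Pi_{W_R}$, $R\in\mathbb N$, where the $\sigma$-field on pairs of measures is generated by the evaluations at measurable sets. **Claim.** Let $(\xi^{(W_R)})_{R\in\mathbb N}$ be a family of probability measures $\xi^{(W_R)}$ on $\mathcal L_{W_R}\times\mathcal S_{W_R}$ that is consistent, i.e., such that $\Pi_{W_{R+1}\to W_R}(\xi^{(W_{R+1})})=\xi^{(W_R)}$ for every $R\in\mathbb N$. Then there exists a unique probability measure $P$ on $\mathcal L\times\mathcal S$ such that $\Pi_{W_R}(P)=\xi^{(W_R)}$ for every $R\in\mathbb N$. Here $\Pi(\mu)=\mu\circ\Pi^{-1}$ denotes the image measure, and $\xi^{(W_R)}$ is also regarded as a measure on the set of all pairs of measures, in which $\mathcal L_{W_R}\times\mathcal S_{W_R}$ is contained. -/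

import Mathlib

open Set MeasureTheory

noncomputable section

namespace BoseGas

/-- Simple point measures are represented by their sets of atoms; this is the corresponding
measure `∑_{p ∈ Γ} δ_p`. -/
def pointMeasure {X : Type*} [MeasurableSpace X] (Γ : Set X) : Measure X :=
  Measure.sum fun p : Γ => Measure.dirac (p : X)

variable (d : ℕ) (β : ℝ)

/-- The space `ℝ^d`. -/
abbrev Space : Type := EuclideanSpace ℝ (Fin d)

/-- The box `W_R = [-R, R]^d`. -/
def box (R : ℕ+) : Set (Space d) := {x | ∀ i, |x i| ≤ (R : ℝ)}

/-! ### Paths with finitely many legs -/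

/-- The space `𝒞 = ⋃_{k ≥ 1} 𝒞_k`, where `𝒞_k` is the set of continuous functions
`[0, kβ] → ℝ^d`. -/
def LegPath : Type := Σ k : ℕ+, C(Icc (0 : ℝ) ((k : ℝ) * β), Space d)

/-- The topology of the disjoint union of the spaces `𝒞_k`, each carrying the topology of uniform
convergence (which is the compact-open topology, since `[0, kβ]` is compact). -/
instance : TopologicalSpace (LegPath d β) :=
  inferInstanceAs (TopologicalSpace (Σ k : ℕ+, C(Icc (0 : ℝ) ((k : ℝ) * β), Space d)))

instance : MeasurableSpace (LegPath d β) := borel _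

instance : BorelSpace (LegPath d β) := ⟨rfl⟩

variable {d β}

/-- The length `ℓ(f) = k` of `f ∈ 𝒞_k`. -/
def LegPath.length (f : LegPath d β) : ℕ := (f.1 : ℕ)

/-- The end time `ℓ(f) β`. -/
def LegPath.duration (f : LegPath d β) : ℝ := (f.length : ℝ) * β

theorem LegPath.length_pos (f : LegPath d β) : 0 < f.length := f.1.pos

theorem LegPath.duration_pos [hβ : Fact (0 < β)] (f : LegPath d β) : 0 < f.duration :=
  mul_pos (Nat.cast_pos.mpr f.length_pos) hβ.out

/-- The value of `f` at time `t`; for `t` outside of `[0, ℓ(f)β]`, this is the value at the endpoint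
that is closest to `t`. -/
def LegPath.eval [hβ : Fact (0 < β)] (f : LegPath d β) (t : ℝ) : Space d :=
  f.2 (projIcc 0 ((f.1 : ℝ) * β)
    (mul_nonneg (Nat.cast_nonneg (f.1 : ℕ)) hβ.out.le) t)

/-! ### Loops -/

variable (d β)

/-- The functions `f ∈ 𝒞` with `f(0) = f(ℓ(f)β)`. -/
def RootedLoop [Fact (0 < β)] : Type := {f : LegPath d β // f.eval 0 = f.eval f.duration}

instance [Fact (0 < β)] : MeasurableSpace (RootedLoop d β) :=
  inferInstanceAs (MeasurableSpace {f : LegPath d β // f.eval 0 = f.eval f.duration})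

variable {d β}

/-- The `ℓ(f)β`-periodic extension of a loop `f` to `ℝ`. -/
def RootedLoop.periodic [Fact (0 < β)] (f : RootedLoop d β) (t : ℝ) : Space d :=
  f.1.eval (toIcoMod f.1.duration_pos 0 t)

variable (d β)

/-- Two loops are identified if they have the same length and are (cyclic) time-shifts of each
other by an integer multiple of `β`. -/
instance loopSetoid [Fact (0 < β)] : Setoid (RootedLoop d β) where
  r f g := f.1.length = g.1.length ∧ ∃ j : ℤ, ∀ t, g.periodic t = f.periodic (t + j * β)
  iseqv :=
    { refl := fun f => ⟨rfl, 0, fun t => by simp⟩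
      symm := by
        rintro f g ⟨h, j, hj⟩
        refine ⟨h.symm, -j, fun t => ?_⟩
        rw [hj]
        congr 1
        push_cast
        ring
      trans := by
        rintro f g h ⟨h1, i, hi⟩ ⟨h2, j, hj⟩
        refine ⟨h1.trans h2, j + i, fun t => ?_⟩
        rw [hj, hi]
        congr 1
        push_cast
        ring }

/-- The loop space `𝒞^↺`. It carries the quotient `σ`-field. (The quotient of each `𝒞_k^↺` is by an
action of the finite group `ℤ/k` by homeomorphisms, hence this is also the Borel `σ`-field of the
quotient topology.) -/
def Loop [Fact (0 < β)] : Type := Quotient (loopSetoid d β)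

instance [Fact (0 < β)] : MeasurableSpace (Loop d β) :=
  inferInstanceAs (MeasurableSpace (Quotient (loopSetoid d β)))

/-- The space of the points `(x, f) ∈ ℝ^d × 𝒞^↺` with `f(0) = x` (for some representative of the
loop `f`). -/
def MarkedLoop [Fact (0 < β)] : Type :=
  {p : Space d × Loop d β // ∃ f : RootedLoop d β, Quotient.mk _ f = p.2 ∧ f.1.eval 0 = p.1}

instance [Fact (0 < β)] : MeasurableSpace (MarkedLoop d β) :=
  inferInstanceAs (MeasurableSpace {p : Space d × Loop d β //
    ∃ f : RootedLoop d β, Quotient.mk _ f = p.2 ∧ f.1.eval 0 = p.1})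

variable {d β}

/-- All the particles `f(kβ)`, `k ∈ ℤ`, of the loop `f` lie in `W`. -/
def Loop.AllIn [Fact (0 < β)] (W : Set (Space d)) : Loop d β → Prop :=
  Quotient.lift (fun f : RootedLoop d β => ∀ k : ℤ, f.periodic (k * β) ∈ W) (by
    have key : ∀ f g : RootedLoop d β, f ≈ g →
        (∀ k : ℤ, f.periodic (k * β) ∈ W) → ∀ k : ℤ, g.periodic (k * β) ∈ W := by
      rintro f g ⟨-, j, hj⟩ hf k
      rw [hj, ← add_mul]
      exact_mod_cast hf (k + j)
    intro f g h
    exact propext ⟨key f g h, key g f (Setoid.symm h)⟩)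

/-! ### Interlacements -/

variable (d β)

/-- The continuous functions `g : ℝ → ℝ^d` such that every compact set contains `g(kβ)` for only
finitely many `k ∈ ℤ`. -/
def Trajectory : Type :=
  {g : C(ℝ, Space d) // ∀ K : Set (Space d), IsCompact K → {k : ℤ | g (k * β) ∈ K}.Finite}

/-- Trajectories are identified if they are time-shifts of each other by an integer multiple
of `β`. -/
instance trajectorySetoid : Setoid (Trajectory d β) where
  r f g := ∃ j : ℤ, ∀ t, g.1 t = f.1 (t + j * β)
  iseqv :=
    { refl := fun f => ⟨0, fun t => by simp⟩
      symm := by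
        rintro f g ⟨j, hj⟩
        refine ⟨-j, fun t => ?_⟩
        rw [hj]
        congr 1
        push_cast
        ring
      trans := by
        rintro f g h ⟨i, hi⟩ ⟨j, hj⟩
        refine ⟨j + i, fun t => ?_⟩
        rw [hj, hi]
        congr 1
        push_cast
        ring }

/-- The interlacement space `𝒞_∞`. -/
def Interlacement : Type := Quotient (trajectorySetoid d β)

variable {d β}

/-- The interlacement has at least one particle `g(kβ)`, `k ∈ ℤ`, in `K`. -/
def Interlacement.Visits (K : Set (Space d)) : Interlacement d β → Prop :=
  Quotient.lift (fun g : Trajectory d β => ∃ k : ℤ, g.1 (k * β) ∈ K) (by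
    have key : ∀ f g : Trajectory d β, f ≈ g →
        (∃ k : ℤ, g.1 (k * β) ∈ K) → ∃ k : ℤ, f.1 (k * β) ∈ K := by
      rintro f g ⟨j, hj⟩ ⟨k, hk⟩
      refine ⟨k + j, ?_⟩
      rw [hj, ← add_mul] at hk
      exact_mod_cast hk
    intro f g h
    exact propext ⟨key g f (Setoid.symm h), key f g h⟩)

/-! ### Shreds -/

section Shreds

variable [Fact (0 < β)] (W : Set (Space d))

/-- `s` is a `W`-shred: it has at least one particle in `W`, and the times `jβ`,
`0 ≤ j ≤ ℓ(s)`, at which `s(jβ) ∉ W` are precisely the initial time `0` and the final time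
`ℓ(s)β`. -/
def IsShred (s : LegPath d β) : Prop :=
  2 ≤ s.length ∧ s.eval 0 ∉ W ∧ s.eval s.duration ∉ W ∧
    ∀ j : ℕ, 1 ≤ j → j < s.length → s.eval (j * β) ∈ W

/-- `s` is the piece of `g : ℝ → ℝ^d` on the time interval `[aβ, (a + ℓ(s))β]`, shifted in time. -/
def IsPiece (g : ℝ → Space d) (a : ℤ) (s : LegPath d β) : Prop :=
  ∀ t ∈ Icc 0 s.duration, s.eval t = g (a * β + t)

/-- `δ_s` if some `W`-shred `s` of `g` begins at time `aβ`, and zero otherwise. (There is at most one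
such `s`, since its length is determined by the first return to the complement of `W`.) -/
def shredAt (g : ℝ → Space d) (a : ℤ) : Measure (LegPath d β) :=
  pointMeasure {s | IsShred W s ∧ IsPiece g a s}

/-- The point measure of all the `W`-shreds of `s`, where `s(0)` and `s(ℓ(s)β)` are assumed to lie
outside of `W`. (Since `s.eval` is constant on `(-∞, 0]` and on `[ℓ(s)β, ∞)`, the windows of these
shreds are contained in `[0, ℓ(s)β]`.) -/
def pathShreds (s : LegPath d β) : Measure (LegPath d β) :=
  Measure.sum fun a : ℤ => shredAt W s.eval a

theorem shredAt_shift (f g : ℝ → Space d) (j : ℤ) (h : ∀ t, g t = f (t + j * β)) (a : ℤ) :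
    shredAt (β := β) W g a = shredAt W f (a + j) := by
  have : ∀ s : LegPath d β, IsPiece g a s ↔ IsPiece f (a + j) s := by
    intro s
    refine forall₂_congr fun t _ => ?_
    rw [h]
    push_cast
    rw [show (a : ℝ) * β + t + j * β = ((a : ℝ) + j) * β + t by ring]
  simp only [shredAt, this]

theorem sum_range_shift {M : Type*} [AddCommMonoid M] (n : ℕ) (F : ℤ → M)
    (hF : ∀ a, F (a + n) = F a) (j : ℤ) :
    ∑ a ∈ Finset.range n, F (a + j) = ∑ a ∈ Finset.range n, F a := by
  have step : ∀ G : ℤ → M, (∀ a, G (a + n) = G a) →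
      ∑ a ∈ Finset.range n, G (a + 1) = ∑ a ∈ Finset.range n, G a := by
    intro G hG
    cases n with
    | zero => simp
    | succ m =>
      rw [Finset.sum_range_succ, Finset.sum_range_succ' (fun a : ℕ => G a)]
      have := hG 0
      simp only [zero_add, Nat.cast_add, Nat.cast_one] at this
      simp [this]
  induction j with
  | zero => simp
  | succ i ih =>
    rw [← ih, ← step (fun a => F (a + i)) (fun a => by rw [← hF (a + i)]; congr 1; ring)]
    refine Finset.sum_congr rfl fun a _ => ?_
    congr 1
    ring
  | pred i ih =>
    rw [← ih, ← step (fun a => F (a + (-i - 1)))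
      (fun a => by rw [← hF (a + (-i - 1))]; congr 1; ring)]
    refine Finset.sum_congr rfl fun a _ => ?_
    congr 1
    ring

theorem RootedLoop.periodic_add (f : RootedLoop d β) (t : ℝ) :
    f.periodic (t + f.1.length * β) = f.periodic t := by
  unfold RootedLoop.periodic
  congr 1
  exact toIcoMod_add_right f.1.duration_pos 0 t

/-- The point measure of all the `W`-shreds of a loop; their initial times are counted modulo the
period of the loop. It is zero if all the particles of the loop lie in `W`, or if none does. -/
def Loop.shreds : Loop d β → Measure (LegPath d β) :=
  Quotient.lift
    (fun f : RootedLoop d β => ∑ a ∈ Finset.range f.1.length, shredAt W f.periodic (a : ℤ)) (by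
    rintro f g ⟨hl, j, hj⟩
    simp only [← hl, shredAt_shift W _ _ j hj]
    refine (sum_range_shift f.1.length (fun a => shredAt W f.periodic a) (fun a => ?_) j).symm
    refine (shredAt_shift W _ _ (f.1.length : ℤ) (fun t => ?_) a).symm
    exact_mod_cast (f.periodic_add t).symm)

/-- The point measure of all the `W`-shreds of an interlacement. -/
def Interlacement.shreds : Interlacement d β → Measure (LegPath d β) :=
  Quotient.lift
    (fun g : Trajectory d β => Measure.sum fun a : ℤ => shredAt W g.1 a) (by
    rintro f g ⟨j, hj⟩
    simp only [shredAt_shift W _ _ j hj]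
    exact (Measure.sum_comp_equiv (Equiv.addRight j) fun a : ℤ => shredAt W f.1 a).symm)

end Shreds

/-! ### Configurations in a box -/

section Configurations

variable [Fact (0 < β)]

variable (β) in
/-- The set `ℒ_W × 𝒮_W` of pairs of a finite simple point measure on the marked loops that have all
their particles in `W` and a finite simple point measure on the `W`-shreds. -/
structure BoxConfig (W : Set (Space d)) where
  loops : Set (MarkedLoop d β)
  shreds : Set (LegPath d β)
  finite_loops : loops.Finite
  finite_shreds : shreds.Finite
  allIn : ∀ p ∈ loops, p.1.2.AllIn W
  isShred : ∀ s ∈ shreds, IsShred W s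

/-- The pair of point measures that a configuration stands for. -/
def BoxConfig.toMeasures {W : Set (Space d)} (c : BoxConfig β W) :
    Measure (MarkedLoop d β) × Measure (LegPath d β) :=
  (pointMeasure c.loops, pointMeasure c.shreds)

/-- The `σ`-field on `ℒ_W × 𝒮_W` that is generated by the evaluations `μ ↦ μ(A)` of the two point
measures at measurable sets `A`. -/
instance (W : Set (Space d)) : MeasurableSpace (BoxConfig β W) :=
  MeasurableSpace.comap BoxConfig.toMeasures inferInstance

/-- The projection `Π_{W' → W}` for `W ⊆ W'`: it keeps the loops that have all their particles in
`W`, and it cuts the other loops and the `W'`-shreds into `W`-shreds. The result is a pair of point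
measures, which need not be simple since the same shred may arise several times. -/
def BoxConfig.proj {W' : Set (Space d)} (W : Set (Space d)) (c : BoxConfig β W') :
    Measure (MarkedLoop d β) × Measure (LegPath d β) :=
  (pointMeasure {p ∈ c.loops | p.1.2.AllIn W},
    (Measure.sum fun p : c.loops => p.1.1.2.shreds W) +
      Measure.sum fun s : c.shreds => pathShreds W (s : LegPath d β))

/-! ### Configurations in the whole space -/

variable (d β) in
/-- The set `ℒ × 𝒮` of loop-interlacement configurations: simple point measures on the marked loops
with only finitely many loops starting in any bounded set, together with simple point measures on
the interlacements with only finitely many particles in any compact set. (As each interlacement has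
only finitely many particles in a compact set, the latter means that only finitely many
interlacements have a particle there.) -/
structure Config where
  loops : Set (MarkedLoop d β)
  interlacements : Set (Interlacement d β)
  finite_loops : ∀ A : Set (Space d), Bornology.IsBounded A → {p ∈ loops | p.1.1 ∈ A}.Finite
  finite_interlacements :
    ∀ K : Set (Space d), IsCompact K → {g ∈ interlacements | g.Visits K}.Finite

/-- The operator `Π_W`: it keeps the loops that have all their particles in `W`, and it cuts the
other loops and the interlacements into `W`-shreds. -/
def Config.proj (W : Set (Space d)) (c : Config d β) :
    Measure (MarkedLoop d β) × Measure (LegPath d β) :=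
  (pointMeasure {p ∈ c.loops | p.1.2.AllIn W},
    (Measure.sum fun p : c.loops => p.1.1.2.shreds W) +
      Measure.sum fun g : c.interlacements => (g : Interlacement d β).shreds W)

/-- The `σ`-field on `ℒ × 𝒮` that is generated by the operators `Π_{W_R}` with `R ∈ ℕ`. -/
instance : MeasurableSpace (Config d β) :=
  ⨆ R : ℕ+, MeasurableSpace.comap (Config.proj (box d R)) inferInstance

end Configurations

end BoseGas

end

/-!
The configurations in a box form a standard Borel space, so that the consistent family `ξ` has an
inverse limit: almost every sequence of configurations in the growing boxes is consistent, and it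
remains to show that a consistent sequence comes from a configuration in the whole space. A loop of
the limit is a loop that lies in some box. A shred `s` in a box is contained, and only once, in a
loop or a larger shred of every later box, because the point measures are simple. If it is never
contained in a loop, then it lies in a unique shred of every later box. These shreds form a tower
whose time windows exhaust the real line, since the endpoints of each of them belong to some later
box, and the tower glues to an interlacement. By simplicity no other interlacement contains `s`, so
that all multiplicities are right.

The measure is unique even if the configuration is not: almost surely the projection to a box is a
measurable function of the projection to the next one, so that the law of a single projection
determines the joint law of all the previous ones.
-/

noncomputable section

namespace BoseGas

/-! ### Standard Borel spaces -/

section StandardBorel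

instance sigma_polishSpace {ι : Type*} [Countable ι] {E : ι → Type*}
    [∀ i, TopologicalSpace (E i)] [∀ i, PolishSpace (E i)] : PolishSpace (Σ i, E i) := by
  let := fun i => TopologicalSpace.upgradeIsCompletelyMetrizable (E i)
  let : MetricSpace (Σ i, E i) := Metric.Sigma.metricSpace
  have : CompleteSpace (Σ i, E i) := Metric.Sigma.completeSpace
  infer_instance

theorem measurable_sigma_iff {ι Y : Type*} {E : ι → Type*} [∀ i, MeasurableSpace (E i)]
    [MeasurableSpace Y] {f : (Σ i, E i) → Y} :
    Measurable f ↔ ∀ i, Measurable fun x => f ⟨i, x⟩ :=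
  ⟨fun h i _ hs => MeasurableSpace.measurableSet_iInf.mp (h hs) i,
    fun h _ hs => MeasurableSpace.measurableSet_iInf.mpr fun i => h i hs⟩

instance sigma_borelSpace {ι : Type*} [Countable ι] {E : ι → Type*}
    [∀ i, TopologicalSpace (E i)] [∀ i, MeasurableSpace (E i)] [∀ i, BorelSpace (E i)] :
    BorelSpace (Σ i, E i) := by
  refine ⟨le_antisymm (fun s hs => ?_) (MeasurableSpace.generateFrom_le fun u hu =>
    MeasurableSpace.measurableSet_iInf.mpr fun i =>
      (hu.preimage continuous_sigmaMk).measurableSet)⟩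
  have hfib : ∀ i, MeasurableSet (Sigma.mk i ⁻¹' s) := MeasurableSpace.measurableSet_iInf.mp hs
  borelize (Σ i, E i)
  rw [← iUnion_image_preimage_sigma_mk_eq_self (s := s)]
  exact MeasurableSet.iUnion fun i =>
    Topology.IsOpenEmbedding.sigmaMk.measurableEmbedding.measurableSet_image.mpr (hfib i)

instance sigma_standardBorelSpace {ι : Type*} [Countable ι] {E : ι → Type*}
    [∀ i, MeasurableSpace (E i)] [∀ i, StandardBorelSpace (E i)] :
    StandardBorelSpace (Σ i, E i) := by
  let := fun i => upgradeStandardBorel (E i)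
  infer_instance

theorem standardBorelSpace_of_measurableEquiv {X Y : Type*} [MeasurableSpace X]
    [StandardBorelSpace X] [MeasurableSpace Y] (e : Y ≃ᵐ X) : StandardBorelSpace Y := by
  let := upgradeStandardBorel X
  let := TopologicalSpace.induced e inferInstance
  have hclosed : Topology.IsClosedEmbedding e :=
    ⟨⟨⟨rfl⟩, e.injective⟩, e.surjective.range_eq ▸ isClosed_univ⟩
  have : PolishSpace Y := hclosed.polishSpace
  have : BorelSpace Y := e.measurableEmbedding.borelSpace hclosed.isInducing
  infer_instance

theorem standardBorelSpace_of_bijective {X Y : Type*} [MeasurableSpace X] [StandardBorelSpace X]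
    [MeasurableSpace Y] [MeasurableSpace.CountablySeparated Y] {f : X → Y} (hf : Measurable f)
    (hbij : Function.Bijective f) : StandardBorelSpace Y :=
  standardBorelSpace_of_measurableEquiv <| MeasurableEquiv.symm
    { Equiv.ofBijective f hbij with
      measurable_toFun := hf
      measurable_invFun := fun s hs => by
        have himage : (Equiv.ofBijective f hbij).symm ⁻¹' s = f '' s :=
          ((Equiv.ofBijective f hbij).image_eq_preimage_symm s).symm
        exact himage ▸ (hf.measurableEmbedding hbij.1).measurableSet_image.mpr hs }

theorem countablySeparated_of_injective {X Y : Type*} [MeasurableSpace X] [MeasurableSpace Y]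
    [MeasurableSpace.CountablySeparated Y] {f : X → Y} (hf : Measurable f)
    (hinj : Function.Injective f) : MeasurableSpace.CountablySeparated X := by
  obtain ⟨S, hcount, hmeas, hsep⟩ := exists_countable_separating Y MeasurableSet univ
  refine ⟨⟨preimage f '' S, hcount.image _, ?_, fun x _ y _ h => hinj ?_⟩⟩
  · rintro _ ⟨s, hs, rfl⟩
    exact hf (hmeas s hs)
  · exact hsep _ trivial _ trivial fun s hs => h _ ⟨s, hs, rfl⟩

theorem measurableEmbedding_of_injOn_comp {X Y Z : Type*} [MeasurableSpace X]
    [StandardBorelSpace X] [MeasurableSpace Y] [MeasurableSpace Z]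
    [MeasurableSpace.CountablySeparated Z] {f : X → Y} {g : Y → Z} {S : Set Y}
    (hf : Measurable f) (hg : Measurable g) (hS : MeasurableSet S) (hfS : ∀ x, f x ∈ S)
    (hfinj : Function.Injective f) (hginj : InjOn g S) : MeasurableEmbedding f := by
  have hgf : MeasurableEmbedding (g ∘ f) :=
    (hg.comp hf).measurableEmbedding fun x y h => hfinj (hginj (hfS x) (hfS y) h)
  refine ⟨hfinj, hf, fun A hA => ?_⟩
  have himage : f '' A = S ∩ g ⁻¹' ((g ∘ f) '' A) := by
    refine subset_antisymm (image_subset_iff.mpr fun x hx => ⟨hfS x, x, hx, rfl⟩) ?_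
    rintro y ⟨hy, x, hx, hxy⟩
    exact ⟨x, hx, hginj (hfS x) hy hxy⟩
  exact himage ▸ hS.inter (hg (hgf.measurableSet_image.mpr hA))

end StandardBorel

section FiniteMeasures

variable (X : Type*) [MeasurableSpace X]

theorem measurableSet_measure_univ_lt_top : MeasurableSet {μ : Measure X | μ univ < ⊤} :=
  measurableSet_lt (Measure.measurable_coe MeasurableSet.univ) measurable_const

variable [StandardBorelSpace X]

/-- The rational values of the distribution function of `μ`, where `X` is identified with a Borel
subset of `ℝ`, together with the total mass of `μ`. For finite measures these countably many numbers
determine `μ`. -/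
def distributionCode (μ : Measure X) : ENNReal × (ℚ → ENNReal) :=
  (μ univ, fun q => μ (embeddingReal X ⁻¹' Iic (q : ℝ)))

theorem measurable_distributionCode : Measurable (distributionCode X) :=
  (Measure.measurable_coe MeasurableSet.univ).prodMk <| measurable_pi_iff.mpr fun _ =>
    Measure.measurable_coe (measurable_embeddingReal X measurableSet_Iic)

theorem injOn_distributionCode : InjOn (distributionCode X) {μ | μ univ < ⊤} := by
  intro μ hμ ν _ h
  have hemb := measurableEmbedding_embeddingReal X
  have : IsFiniteMeasure μ := ⟨hμ⟩
  obtain ⟨huniv, hIic⟩ := Prod.ext_iff.mp h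
  refine hemb.map_injective (ext_of_generate_finite _ (BorelSpace.measurable_eq.trans
    Real.borel_eq_generateFrom_Iic_rat) Real.isPiSystem_Iic_rat (fun s hs => ?_) ?_)
  · obtain ⟨q, rfl⟩ := mem_iUnion.mp hs
    rw [hemb.map_apply, hemb.map_apply]
    exact congrFun hIic q
  · rw [hemb.map_apply, hemb.map_apply]
    exact huniv

variable (Y : Type*) [MeasurableSpace Y] [StandardBorelSpace Y]

theorem measurable_prodMap_distributionCode :
    Measurable (Prod.map (distributionCode X) (distributionCode Y)) :=
  ((measurable_distributionCode X).comp measurable_fst).prodMk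
    ((measurable_distributionCode Y).comp measurable_snd)

theorem injOn_prodMap_distributionCode :
    InjOn (Prod.map (distributionCode X) (distributionCode Y))
      ({μ | μ univ < ⊤} ×ˢ {μ | μ univ < ⊤}) := fun _ hμ _ hν h =>
  Prod.ext (injOn_distributionCode X hμ.1 hν.1 (Prod.ext_iff.mp h).1)
    (injOn_distributionCode Y hμ.2 hν.2 (Prod.ext_iff.mp h).2)

end FiniteMeasures

/-! ### Inverse limits of probability spaces -/

section MarkovChain

open ProbabilityTheory

theorem map_compProd_comap {α β γ : Type*} [MeasurableSpace α] [MeasurableSpace β]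
    [MeasurableSpace γ] (μ : Measure α) [SFinite μ] (κ : Kernel β γ) [IsSFiniteKernel κ]
    {f : α → β} (hf : Measurable f) :
    (μ ⊗ₘ κ.comap f hf).map (Prod.map f id) = μ.map f ⊗ₘ κ := by
  ext s hs
  rw [Measure.map_apply (hf.prodMap measurable_id) hs, Measure.compProd_apply hs,
    Measure.compProd_apply ((hf.prodMap measurable_id) hs),
    lintegral_map (Kernel.measurable_kernel_prodMk_left hs) hf]
  rfl

variable {B : ℕ → Type*} [∀ n, MeasurableSpace (B n)]

/-- The projection of a path up to time `n` to its value at time `n`. -/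
def lastCoord (n : ℕ) (x : Π i : Finset.Iic n, B i) : B n := x ⟨n, Finset.mem_Iic.mpr le_rfl⟩

@[fun_prop]
theorem measurable_lastCoord (n : ℕ) : Measurable (lastCoord (B := B) n) :=
  measurable_pi_apply _

/-- The law of the Markov chain with initial law `μ₀` and transition kernels `κ n`. -/
def chainMeasure (μ₀ : Measure (B 0)) (κ : ∀ n, Kernel (B n) (B (n + 1)))
    [∀ n, IsMarkovKernel (κ n)] : Measure (∀ n, B n) :=
  Kernel.trajMeasure (X := B) μ₀ fun n => (κ n).comap (lastCoord n) (measurable_lastCoord n)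

variable (μ₀ : Measure (B 0)) (κ : ∀ n, Kernel (B n) (B (n + 1)))
  [∀ n, IsMarkovKernel (κ n)]

instance [IsProbabilityMeasure μ₀] : IsProbabilityMeasure (chainMeasure μ₀ κ) := by
  unfold chainMeasure
  infer_instance

theorem map_chainMeasure_zero : (chainMeasure μ₀ κ).map (fun x => x 0) = μ₀ := by
  change (chainMeasure μ₀ κ).map (lastCoord 0 ∘ Preorder.frestrictLe 0) = μ₀
  rw [← Measure.map_map (by fun_prop) (by fun_prop), chainMeasure, Kernel.trajMeasure,
    Measure.map_comp _ _ (by fun_prop), Kernel.traj_map_frestrictLe, Kernel.partialTraj_self,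
    Measure.id_comp]
  exact (Measure.map_map (by fun_prop) (MeasurableEquiv.measurable _)).trans Measure.map_id

theorem map_chainMeasure_pair [IsProbabilityMeasure μ₀] (n : ℕ) :
    (chainMeasure μ₀ κ).map (fun x => (x n, x (n + 1))) =
      (chainMeasure μ₀ κ).map (fun x => x n) ⊗ₘ κ n := by
  have h := congrArg (Measure.map (Prod.map (lastCoord n) id))
    (Kernel.map_frestrictLe_trajMeasure_compProd_eq_map_trajMeasure (X := B) (μ₀ := μ₀)
      (κ := fun n => (κ n).comap (lastCoord n) (measurable_lastCoord n)) (a := n))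
  rw [map_compProd_comap, Measure.map_map (by fun_prop) (by fun_prop),
    Measure.map_map (by fun_prop) (by fun_prop)] at h
  exact h.symm

end MarkovChain

section InverseLimit

open Filter ProbabilityTheory

variable {B : ℕ → Type*} [∀ n, MeasurableSpace (B n)]

theorem exists_measure_inverseLimit [∀ n, StandardBorelSpace (B n)]
    (ξ : ∀ n, Measure (B n)) [∀ n, IsProbabilityMeasure (ξ n)] {q : ∀ n, B (n + 1) → B n}
    (hq : ∀ n, Measurable (q n)) (hmap : ∀ n, (ξ (n + 1)).map (q n) = ξ n) :
    ∃ Q : Measure (∀ n, B n), IsProbabilityMeasure Q ∧ (∀ n, Q.map (fun x => x n) = ξ n) ∧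
      ∀ n, ∀ᵐ x ∂Q, x n = q n (x (n + 1)) := by
  have (n : ℕ) : Nonempty (B n) := nonempty_of_isProbabilityMeasure (ξ n)
  let Q := chainMeasure (ξ 0) fun n => condDistrib id (q n) (ξ (n + 1))
  have pair : ∀ n, Q.map (fun x => x n) = ξ n →
      Q.map (fun x => (x n, x (n + 1))) = (ξ (n + 1)).map (fun y => (q n y, y)) := fun n hn => by
    rw [map_chainMeasure_pair]
    change Q.map _ ⊗ₘ _ = _
    rw [hn, ← hmap n, compProd_map_condDistrib aemeasurable_id]
    rfl
  have marginal : ∀ n, Q.map (fun x => x n) = ξ n := fun n => by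
    induction n with
    | zero => exact map_chainMeasure_zero _ _
    | succ n ih =>
      have h := congrArg (Measure.map Prod.snd) (pair n ih)
      rw [Measure.map_map (by fun_prop) (by fun_prop),
        Measure.map_map (by fun_prop) ((hq n).prodMk measurable_id')] at h
      exact h.trans Measure.map_id
  refine ⟨Q, inferInstance, marginal, fun n => ?_⟩
  have graph : ∀ᵐ z ∂(Q.map (fun x => (x n, x (n + 1)))), z.1 = q n z.2 := by
    have hgraph : MeasurableSet {z : B n × B (n + 1) | z.1 = q n z.2} :=
      measurableSet_eq_fun measurable_fst ((hq n).comp measurable_snd)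
    rw [pair n (marginal n), ae_map_iff ((hq n).prodMk measurable_id').aemeasurable hgraph]
    exact Eventually.of_forall fun _ => rfl
  exact ae_of_ae_map (by fun_prop) graph

theorem exists_measurable_lift {X Y M : Type*} [MeasurableSpace X] [MeasurableSpace Y]
    [MeasurableSpace M] {μ : Measure X} {ν : Measure Y} [NeZero ν] {p : X → M}
    {T : Y → M} (hT : MeasurableEmbedding T) (h : μ.map p = ν.map T) :
    ∃ q : X → Y, Measurable q ∧ T ∘ q =ᵐ[μ] p ∧ μ.map q = ν := by
  have : Nonempty Y := ν.nonempty_of_neZero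
  have hp : AEMeasurable p μ := by
    by_contra hp
    rw [Measure.map_of_not_aemeasurable hp] at h
    exact NeZero.ne ν ((Measure.map_eq_zero_iff hT.measurable.aemeasurable).mp h.symm)
  have hq : Measurable (hT.invFun ∘ hp.mk) := hT.measurable_invFun.comp hp.measurable_mk
  have hTq : T ∘ hT.invFun ∘ hp.mk =ᵐ[μ] p := by
    have hrange : ∀ᵐ y ∂(μ.map p), y ∈ range T := by
      rw [h, hT.ae_map_iff]
      exact Eventually.of_forall mem_range_self
    filter_upwards [ae_of_ae_map hp hrange, hp.ae_eq_mk] with x ⟨y, hy⟩ hx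
    rw [Function.comp_apply, Function.comp_apply, ← hx, ← hy, hT.leftInverse_invFun]
  refine ⟨_, hq, hTq, hT.map_injective ?_⟩
  rw [Measure.map_map hT.measurable hq, ← h]
  exact Measure.map_congr hTq

theorem measurable_of_eq_iSup_comap {C M ι : Type*} [MeasurableSpace M]
    [mC : MeasurableSpace C] {π : ι → C → M}
    (hmC : mC = ⨆ n, MeasurableSpace.comap (π n) inferInstance)
    (n : ι) : Measurable (π n) := by
  rw [measurable_iff_comap_le, hmC]
  exact le_iSup (fun n => MeasurableSpace.comap (π n) ‹_›) n

theorem measurable_to_iSup_comap {C D M ι : Type*} [MeasurableSpace M] [MeasurableSpace D]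
    [mC : MeasurableSpace C] {π : ι → C → M}
    (hmC : mC = ⨆ n, MeasurableSpace.comap (π n) inferInstance)
    {f : D → C} (hf : ∀ n, Measurable (π n ∘ f)) : Measurable f := by
  rw [measurable_iff_comap_le, hmC, MeasurableSpace.comap_iSup]
  exact iSup_le fun n => MeasurableSpace.comap_comp.trans_le (hf n).comap_le

/-- Any choice of gluings is measurable on a measurable set of consistent sequences, because the
maps `π n` generate the `σ`-field of `C`. -/
theorem exists_measure_of_consistent {M C : Type*} [MeasurableSpace M] [mC : MeasurableSpace C]
    [∀ n, StandardBorelSpace (B n)] {T : ∀ n, B n → M}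
    (hT : ∀ n, Measurable (T n)) {p : ∀ n, B (n + 1) → M} (ξ : ∀ n, Measure (B n))
    [∀ n, IsProbabilityMeasure (ξ n)] {q : ∀ n, B (n + 1) → B n} (hq : ∀ n, Measurable (q n))
    (hTq : ∀ n, T n ∘ q n =ᵐ[ξ (n + 1)] p n) (hmap : ∀ n, (ξ (n + 1)).map (q n) = ξ n)
    {π : ℕ → C → M} (hmC : mC = ⨆ n, MeasurableSpace.comap (π n) inferInstance)
    (glue : ∀ b : ∀ n, B n, (∀ n, p n (b (n + 1)) = T n (b n)) → ∃ c, ∀ n, π n c = T n (b n)) :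
    ∃ P : Measure C, IsProbabilityMeasure P ∧ ∀ n, P.map (π n) = (ξ n).map (T n) := by
  classical
  obtain ⟨Q, hQ, marginal, hchain⟩ := exists_measure_inverseLimit ξ hq hmap
  have consistent : ∀ᵐ x ∂Q, ∀ n, p n (x (n + 1)) = T n (x n) := by
    refine ae_all_iff.mpr fun n => ?_
    have h := hTq n
    rw [← marginal (n + 1)] at h
    filter_upwards [ae_of_ae_map (measurable_pi_apply _).aemeasurable h, hchain n] with x h1 h2
    rw [h2, ← h1, Function.comp_apply]
  obtain ⟨G, hG, hGm, hGood⟩ := consistent.exists_measurable_mem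
  obtain ⟨x₀, hx₀⟩ : G.Nonempty := nonempty_of_mem hG
  have : Nonempty C := (glue x₀ (hGood x₀ hx₀)).nonempty
  choose! Ψ hΨ using glue
  have hπΨ : ∀ n, π n ∘ G.piecewise Ψ (fun _ => Ψ x₀) =
      G.piecewise (fun x => T n (x n)) fun _ => T n (x₀ n) := fun n => by
    funext x
    by_cases hx : x ∈ G
    · simp [hx, hΨ _ (hGood x hx)]
    · simp [hx, hΨ _ (hGood x₀ hx₀)]
  have hmeas : Measurable (G.piecewise Ψ fun _ => Ψ x₀) :=
    measurable_to_iSup_comap hmC fun n => hπΨ n ▸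
      Measurable.piecewise hGm ((hT n).comp (measurable_pi_apply n)) measurable_const
  refine ⟨_, Measure.isProbabilityMeasure_map (μ := Q) hmeas.aemeasurable, fun n => ?_⟩
  rw [Measure.map_map (measurable_of_eq_iSup_comap hmC n) hmeas, ← marginal n,
    Measure.map_map (hT n) (measurable_pi_apply n), hπΨ]
  refine Measure.map_congr ?_
  filter_upwards [hG] with x hx using piecewise_eq_of_mem _ _ _ hx

theorem exists_measurable_factor {C M : Type*} [MeasurableSpace C] [MeasurableSpace M]
    {μ : Measure C} {Y : ℕ → C → M} {r : ℕ → M → M} (hr : ∀ n, Measurable (r n))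
    (hY : ∀ n, Y n =ᵐ[μ] r n ∘ Y (n + 1)) {i n : ℕ} (hin : i ≤ n) :
    ∃ h : M → M, Measurable h ∧ Y i =ᵐ[μ] h ∘ Y n := by
  induction n, hin using Nat.le_induction with
  | base => exact ⟨id, measurable_id, EventuallyEq.rfl⟩
  | succ n _ ih =>
    obtain ⟨h, hh, hYh⟩ := ih
    refine ⟨h ∘ r n, hh.comp (hr n), ?_⟩
    filter_upwards [hYh, hY n] with c h1 h2
    rw [h1, Function.comp_apply, h2]
    rfl

/-- Each finite-dimensional marginal is a function of a single late coordinate. -/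
theorem map_process_eq {C M : Type*} [MeasurableSpace C] [MeasurableSpace M] {μ ν : Measure C}
    [IsFiniteMeasure μ] {Y : ℕ → C → M} (hYm : ∀ n, Measurable (Y n)) {r : ℕ → M → M}
    (hr : ∀ n, Measurable (r n)) (hY : ∀ n, Y n =ᵐ[μ + ν] r n ∘ Y (n + 1))
    (hmap : ∀ n, μ.map (Y n) = ν.map (Y n)) :
    μ.map (fun c n => Y n c) = ν.map (fun c n => Y n c) := by
  have hproc : Measurable fun c n => Y n c := measurable_pi_iff.mpr hYm
  refine IsProjectiveLimit.unique (P := fun I : Finset ℕ => (μ.map fun c n => Y n c).map I.restrict)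
    (fun _ => rfl) fun I => ?_
  choose h hh hYh using fun i : I => exists_measurable_factor hr hY (Finset.le_sup (f := id) i.2)
  have hfactor : (I.restrict ∘ fun c n => Y n c) =ᵐ[μ + ν]
      (fun y i => h i y) ∘ Y (I.sup id) := by
    filter_upwards [ae_all_iff.mpr hYh] with c hc using funext hc
  have hhm : Measurable fun y i => h i y := measurable_pi_iff.mpr hh
  obtain ⟨hμ, hν⟩ := ae_add_measure_iff.mp hfactor
  change (ν.map _).map _ = (μ.map _).map _
  rw [Measure.map_map (Finset.measurable_restrict I) hproc,
    Measure.map_map (Finset.measurable_restrict I) hproc, Measure.map_congr hμ,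
    Measure.map_congr hν, ← Measure.map_map hhm (hYm _), ← Measure.map_map hhm (hYm _), hmap]

theorem measure_ext_of_map_process {C M : Type*} [MeasurableSpace M] [mC : MeasurableSpace C]
    {π : ℕ → C → M} (hmC : mC = ⨆ n, MeasurableSpace.comap (π n) inferInstance) {μ ν : Measure C}
    (h : μ.map (fun c n => π n c) = ν.map (fun c n => π n c)) : μ = ν := by
  have hcomap : mC = MeasurableSpace.comap (fun c n => π n c) MeasurableSpace.pi := by
    simp only [hmC, MeasurableSpace.pi, MeasurableSpace.comap_iSup, MeasurableSpace.comap_comp]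
    rfl
  have hmeas : Measurable fun c n => π n c := measurable_iff_comap_le.mpr hcomap.ge
  ext s hs
  rw [hcomap] at hs
  obtain ⟨t, ht, rfl⟩ := hs
  rw [← Measure.map_apply hmeas ht, h, Measure.map_apply hmeas ht]

/-- The connecting maps `p n` have values in the larger space `M`, since the projection of a simple
configuration need not be simple. -/
theorem existsUnique_measure_of_consistent {M C : Type*} [MeasurableSpace M]
    [mC : MeasurableSpace C] [∀ n, StandardBorelSpace (B n)]
    {T : ∀ n, B n → M} (hT : ∀ n, MeasurableEmbedding (T n)) {p : ∀ n, B (n + 1) → M}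
    (ξ : ∀ n, Measure (B n)) [∀ n, IsProbabilityMeasure (ξ n)]
    (hcons : ∀ n, (ξ (n + 1)).map (p n) = (ξ n).map (T n)) {π : ℕ → C → M}
    (hmC : mC = ⨆ n, MeasurableSpace.comap (π n) inferInstance)
    (glue : ∀ b : ∀ n, B n, (∀ n, p n (b (n + 1)) = T n (b n)) → ∃ c, ∀ n, π n c = T n (b n))
    (compat : ∀ c n b, π (n + 1) c = T (n + 1) b → π n c = p n b) :
    ∃! P : Measure C, IsProbabilityMeasure P ∧ ∀ n, P.map (π n) = (ξ n).map (T n) := by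
  have (n : ℕ) : Nonempty (B n) := nonempty_of_isProbabilityMeasure (ξ n)
  choose q hq hTq hmap using fun n => exists_measurable_lift (hT n) (hcons n)
  refine existsUnique_of_exists_of_unique (exists_measure_of_consistent
    (fun n => (hT n).measurable) ξ hq hTq hmap hmC glue) ?_
  have hπ : ∀ n, Measurable (π n) := measurable_of_eq_iSup_comap hmC
  have recover : ∀ P : Measure C, (∀ n, P.map (π n) = (ξ n).map (T n)) → ∀ n,
      π n =ᵐ[P] (T n ∘ q n ∘ (hT (n + 1)).invFun) ∘ π (n + 1) := fun P hP n => by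
    have h : ∀ᵐ y ∂(P.map (π (n + 1))), ∃ b, y = T (n + 1) b ∧ T n (q n b) = p n b := by
      rw [hP, (hT _).ae_map_iff]
      filter_upwards [hTq n] with b hb using ⟨b, rfl, hb⟩
    filter_upwards [ae_of_ae_map (hπ _).aemeasurable h] with c ⟨b, hb, hqb⟩
    simp only [compat c n b hb, ← hqb, hb, Function.comp_apply, (hT _).leftInverse_invFun b]
  rintro P P' ⟨_, hP⟩ ⟨_, hP'⟩
  refine measure_ext_of_map_process hmC (map_process_eq hπ
    (fun n => (hT n).measurable.comp ((hq n).comp (hT (n + 1)).measurable_invFun))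
    (fun n => ?_) fun n => (hP n).trans (hP' n).symm)
  exact ae_add_measure_iff.mpr ⟨recover P hP n, recover P' hP' n⟩

end InverseLimit

/-! ### Paths and loops -/

section Paths

variable {d : ℕ} {β : ℝ}

instance : PolishSpace (LegPath d β) :=
  inferInstanceAs (PolishSpace (Σ k : ℕ+, C(Icc (0 : ℝ) ((k : ℝ) * β), Space d)))

theorem LegPath.measurable_length : Measurable (LegPath.length : LegPath d β → ℕ) := by
  have hcontinuous : Continuous (LegPath.length : LegPath d β → ℕ) :=
    continuous_sigma fun k => (continuous_const : Continuous fun _ => (k : ℕ))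
  exact hcontinuous.measurable

variable [hβ : Fact (0 < β)]

theorem LegPath.eval_of_mem (f : LegPath d β) {t : ℝ} (ht : t ∈ Icc 0 f.duration) :
    f.eval t = f.2 ⟨t, ht⟩ :=
  congrArg f.2 (projIcc_of_mem _ ht)

theorem LegPath.continuous_eval (f : LegPath d β) : Continuous f.eval :=
  f.2.continuous.comp continuous_projIcc

theorem LegPath.eval_of_nonpos (f : LegPath d β) {t : ℝ} (ht : t ≤ 0) : f.eval t = f.eval 0 :=
  congrArg f.2 ((projIcc_of_le_left _ ht).trans (projIcc_left ..).symm)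

theorem LegPath.eval_of_duration_le (f : LegPath d β) {t : ℝ} (ht : f.duration ≤ t) :
    f.eval t = f.eval f.duration :=
  congrArg f.2 ((projIcc_of_right_le _ ht).trans (projIcc_right ..).symm)

theorem LegPath.ext {f g : LegPath d β} (hlength : f.length = g.length)
    (heval : EqOn f.eval g.eval (Icc 0 f.duration)) : f = g := by
  obtain ⟨k, f⟩ := f
  obtain ⟨l, g⟩ := g
  obtain rfl : k = l := PNat.coe_injective hlength
  congr 1
  ext1 t
  exact (LegPath.eval_of_mem ⟨k, f⟩ t.2).symm.trans
    ((heval t.2).trans (LegPath.eval_of_mem ⟨k, g⟩ t.2))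

/-- The piece of the continuous function `g` on `[aβ, (a + n)β]`, shifted in time. -/
def LegPath.cut (g : C(ℝ, Space d)) (a : ℤ) (n : ℕ+) : LegPath d β :=
  ⟨n, ⟨fun t => g (a * β + t), by fun_prop⟩⟩

theorem LegPath.isPiece_cut (g : C(ℝ, Space d)) (a : ℤ) (n : ℕ+) :
    IsPiece g a (LegPath.cut g a n : LegPath d β) := fun _ ht =>
  LegPath.eval_of_mem _ ht

theorem LegPath.measurable_eval_time {τ : LegPath d β → ℝ}
    (hτ : ∀ k : ℕ+, ∃ t, ∀ f : C(Icc (0 : ℝ) ((k : ℝ) * β), Space d), τ ⟨k, f⟩ = t) :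
    Measurable fun f : LegPath d β => f.eval (τ f) := by
  have hcontinuous : Continuous fun f : LegPath d β => f.eval (τ f) := by
    refine continuous_sigma fun k => ?_
    obtain ⟨t, ht⟩ := hτ k
    have heval := continuous_eval_const (F := C(Icc (0 : ℝ) ((k : ℝ) * β), Space d))
      (projIcc 0 _ (mul_nonneg (Nat.cast_nonneg (k : ℕ)) hβ.out.le) t)
    exact heval.congr fun f => (congrArg (LegPath.eval ⟨k, f⟩) (ht f)).symm
  exact hcontinuous.measurable

theorem LegPath.measurable_eval (t : ℝ) : Measurable fun f : LegPath d β => f.eval t :=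
  LegPath.measurable_eval_time fun _ => ⟨t, fun _ => rfl⟩

theorem LegPath.measurable_eval_duration :
    Measurable fun f : LegPath d β => f.eval f.duration :=
  LegPath.measurable_eval_time fun k => ⟨(k : ℕ) * β, fun _ => rfl⟩

theorem measurableSet_isShred {W : Set (Space d)} (hW : MeasurableSet W) :
    MeasurableSet {s : LegPath d β | IsShred W s} := by
  refine (measurableSet_le measurable_const LegPath.measurable_length).inter
    ((LegPath.measurable_eval 0 hW.compl).inter
      ((LegPath.measurable_eval_duration hW.compl).inter ?_))
  change MeasurableSet {s : LegPath d β | ∀ j : ℕ, 1 ≤ j → j < s.length → s.eval (j * β) ∈ W}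
  simp only [ofPred_forall]
  refine MeasurableSet.iInter fun j => MeasurableSet.iInter fun _ => ?_
  simp only [imp_iff_not_or]
  exact (measurableSet_lt measurable_const LegPath.measurable_length).compl.union
    (LegPath.measurable_eval _ hW)

theorem RootedLoop.periodic_of_mem (f : RootedLoop d β) {t : ℝ} (ht : t ∈ Icc 0 f.1.duration) :
    f.periodic t = f.1.eval t := by
  rcases ht.2.eq_or_lt with rfl | hlt
  · have hmod : toIcoMod f.1.duration_pos 0 f.1.duration = 0 := by
      simpa using toIcoMod_apply_right f.1.duration_pos 0
    exact (congrArg f.1.eval hmod).trans f.2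
  · exact congrArg f.1.eval
      ((toIcoMod_eq_self f.1.duration_pos).mpr ⟨ht.1, by rwa [zero_add]⟩)

theorem RootedLoop.periodic_zero (f : RootedLoop d β) : f.periodic 0 = f.1.eval 0 :=
  f.periodic_of_mem ⟨le_rfl, f.1.duration_pos.le⟩

theorem RootedLoop.periodic_duration (f : RootedLoop d β) :
    Function.Periodic f.periodic f.1.duration :=
  f.periodic_add

theorem RootedLoop.periodic_eq_of_eqOn {f : RootedLoop d β} {g : ℝ → Space d}
    (hg : Function.Periodic g f.1.duration) (h : EqOn f.1.eval g (Icc 0 f.1.duration)) :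
    f.periodic = g := by
  funext t
  have ht := toIcoMod_mem_Ico f.1.duration_pos 0 t
  rw [zero_add] at ht
  refine (h ⟨ht.1, ht.2.le⟩).trans ?_
  rw [← self_sub_toIcoDiv_zsmul]
  exact hg.sub_zsmul_eq _

theorem RootedLoop.ext {f g : RootedLoop d β} (hlength : f.1.length = g.1.length)
    (hperiodic : f.periodic = g.periodic) : f = g := by
  have hduration : f.1.duration = g.1.duration := congrArg (fun n : ℕ => (n : ℝ) * β) hlength
  refine Subtype.ext (LegPath.ext hlength fun t ht => ?_)
  rw [← f.periodic_of_mem ht, hperiodic, g.periodic_of_mem (hduration ▸ ht)]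

theorem RootedLoop.continuous_periodic (f : RootedLoop d β) : Continuous f.periodic := by
  have : Fact (0 < f.1.duration) := ⟨f.1.duration_pos⟩
  have hlift : Continuous (AddCircle.liftIco f.1.duration 0 f.1.eval) :=
    AddCircle.liftIco_continuous ((zero_add f.1.duration).symm ▸ f.2)
      f.1.continuous_eval.continuousOn
  have hperiodic : f.periodic = fun t : ℝ => AddCircle.liftIco f.1.duration 0 f.1.eval t := by
    refine RootedLoop.periodic_eq_of_eqOn (fun t => by simp) fun t ht => ?_
    rcases ht.2.eq_or_lt with rfl | hlt
    · rw [← f.2, AddCircle.coe_period, ← AddCircle.coe_zero, AddCircle.liftIco_coe_apply]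
      simpa using f.1.duration_pos
    · rw [AddCircle.liftIco_coe_apply (by simpa using ⟨ht.1, hlt⟩)]
  exact hperiodic ▸ hlift.comp (AddCircle.continuous_mk' _)

theorem RootedLoop.measurable_periodic (t : ℝ) :
    Measurable fun f : RootedLoop d β => f.periodic t :=
  (LegPath.measurable_eval_time (τ := fun f => toIcoMod f.duration_pos 0 t) fun k =>
    ⟨toIcoMod (mul_pos (Nat.cast_pos.mpr k.pos) hβ.out) 0 t, fun _ => rfl⟩).comp
      measurable_subtype_coe

instance : StandardBorelSpace (RootedLoop d β) :=
  MeasurableSet.standardBorel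
    (measurableSet_eq_fun (LegPath.measurable_eval 0) LegPath.measurable_eval_duration)

/-- The rooted loop that starts at the time `jβ` of the periodic extension of `f`. -/
def RootedLoop.shift (f : RootedLoop d β) (j : ℤ) : RootedLoop d β :=
  ⟨LegPath.cut ⟨f.periodic, f.continuous_periodic⟩ j f.1.1, by
    have hpiece := LegPath.isPiece_cut (β := β) ⟨f.periodic, f.continuous_periodic⟩ j f.1.1
    rw [hpiece 0 ⟨le_rfl, (LegPath.duration_pos _).le⟩,
      hpiece _ ⟨(LegPath.duration_pos _).le, le_rfl⟩]
    exact (congrArg f.periodic (add_zero _)).trans (f.periodic_duration _).symm⟩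

theorem RootedLoop.periodic_shift (f : RootedLoop d β) (j : ℤ) (t : ℝ) :
    (f.shift j).periodic t = f.periodic (t + j * β) := by
  have h : (f.shift j).periodic = fun t => f.periodic (j * β + t) :=
    RootedLoop.periodic_eq_of_eqOn (f.periodic_duration.const_add _)
      (LegPath.isPiece_cut ⟨f.periodic, f.continuous_periodic⟩ j f.1.1)
  rw [h, add_comm]

theorem RootedLoop.eval_shift_zero (f : RootedLoop d β) (j : ℤ) :
    (f.shift j).1.eval 0 = f.periodic (j * β) := by
  rw [← RootedLoop.periodic_zero, f.periodic_shift, zero_add]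

theorem RootedLoop.shift_zero (f : RootedLoop d β) : f.shift 0 = f :=
  RootedLoop.ext rfl (funext fun t => by simp [RootedLoop.periodic_shift])

theorem RootedLoop.shift_shift (f : RootedLoop d β) (i j : ℤ) :
    (f.shift i).shift j = f.shift (j + i) := by
  refine RootedLoop.ext rfl (funext fun t => ?_)
  simp only [RootedLoop.periodic_shift, Int.cast_add, add_mul, add_assoc]

theorem RootedLoop.equiv_iff {f g : RootedLoop d β} : f ≈ g ↔ ∃ j, f.shift j = g := by
  refine ⟨fun ⟨hlength, j, hj⟩ => ⟨j, RootedLoop.ext hlength (funext fun t => ?_)⟩, ?_⟩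
  · rw [f.periodic_shift, hj]
  · rintro ⟨j, rfl⟩
    exact ⟨rfl, j, f.periodic_shift j⟩

theorem RootedLoop.shift_neg_shift (f : RootedLoop d β) (j : ℤ) : (f.shift j).shift (-j) = f := by
  rw [f.shift_shift, neg_add_cancel, f.shift_zero]

theorem RootedLoop.finite_range_shift (f : RootedLoop d β) : (range f.shift).Finite := by
  have hperiodic : Function.Periodic f.shift (f.1.length : ℤ) := fun j => by
    refine RootedLoop.ext rfl (funext fun t => ?_)
    simp only [RootedLoop.periodic_shift, Int.cast_add, Int.cast_natCast, add_mul, ← add_assoc]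
    exact f.periodic_duration _
  rw [← hperiodic.image_Icc (by exact_mod_cast f.1.length_pos) 0]
  exact (finite_Icc _ _).image _

/-- A real number that encodes the values of the periodic extension of `f` on a countable dense
set. -/
def RootedLoop.code (f : RootedLoop d β) : ℝ :=
  embeddingReal (ℚ → Space d) fun q => f.periodic (q * β)

theorem RootedLoop.measurable_code_shift (j : ℤ) :
    Measurable fun f : RootedLoop d β => (f.shift j).code := by
  simp only [RootedLoop.code, RootedLoop.periodic_shift]
  exact (measurable_embeddingReal _).comp
    (measurable_pi_iff.mpr fun _ => RootedLoop.measurable_periodic _)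

theorem RootedLoop.measurable_code : Measurable (RootedLoop.code : RootedLoop d β → ℝ) :=
  (measurable_embeddingReal _).comp
    (measurable_pi_iff.mpr fun _ => RootedLoop.measurable_periodic _)

theorem RootedLoop.eq_of_code_eq {f g : RootedLoop d β} (hlength : f.1.length = g.1.length)
    (hcode : f.code = g.code) : f = g := by
  have hdense : DenseRange fun q : ℚ => (q : ℝ) * β :=
    (mul_right_surjective₀ hβ.out.ne').denseRange.comp Rat.denseRange_cast (by fun_prop)
  exact RootedLoop.ext hlength (hdense.equalizer f.continuous_periodic g.continuous_periodic
    ((measurableEmbedding_embeddingReal _).injective hcode))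

/-- The length of a loop, together with the least of the codes of its rooted representatives. -/
def Loop.code : Loop d β → ℕ × ℝ :=
  Quotient.lift (fun f : RootedLoop d β => (f.1.length, ⨅ j : ℤ, (f.shift j).code)) (by
    intro f g hfg
    obtain ⟨j, rfl⟩ := RootedLoop.equiv_iff.mp hfg
    simp only [RootedLoop.shift_shift]
    exact Prod.ext rfl ((Equiv.addRight j).iInf_comp (g := fun i => (f.shift i).code)).symm)

theorem Loop.measurable_code : Measurable (Loop.code : Loop d β → ℕ × ℝ) :=
  measurable_from_quotient.mpr <|
    (LegPath.measurable_length.comp measurable_subtype_coe).prodMk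
      (Measurable.iInf RootedLoop.measurable_code_shift)

theorem RootedLoop.exists_code_shift_eq_iInf (f : RootedLoop d β) :
    ∃ i : ℤ, (f.shift i).code = ⨅ j : ℤ, (f.shift j).code :=
  (range_nonempty _).csInf_mem
    (range_comp RootedLoop.code f.shift ▸ f.finite_range_shift.image _)

theorem Loop.code_injective : Function.Injective (Loop.code : Loop d β → ℕ × ℝ) := by
  rintro ⟨f⟩ ⟨g⟩ h
  obtain ⟨hlength, hinf⟩ := Prod.ext_iff.mp h
  obtain ⟨i, hi⟩ := f.exists_code_shift_eq_iInf
  obtain ⟨j, hj⟩ := g.exists_code_shift_eq_iInf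
  have hshift : f.shift i = g.shift j :=
    RootedLoop.eq_of_code_eq hlength (hi.trans (hinf.trans hj.symm))
  refine Quotient.sound (RootedLoop.equiv_iff.mpr ⟨-j + i, ?_⟩)
  rw [← f.shift_shift, hshift, g.shift_neg_shift]

/-- The rooted loops that have the least code among all their shifts with the same root: a
measurable set of representatives of the marked loops. -/
def canonicalLoops (d : ℕ) (β : ℝ) [Fact (0 < β)] : Set (RootedLoop d β) :=
  {f | ∀ j : ℤ, f.periodic (j * β) = f.1.eval 0 → f.code ≤ (f.shift j).code}

theorem measurableSet_canonicalLoops : MeasurableSet (canonicalLoops d β) := by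
  simp only [canonicalLoops, ofPred_forall, imp_iff_not_or]
  exact MeasurableSet.iInter fun j =>
    (measurableSet_eq_fun (RootedLoop.measurable_periodic _)
      ((LegPath.measurable_eval 0).comp measurable_subtype_coe)).compl.union
    (measurableSet_le RootedLoop.measurable_code (RootedLoop.measurable_code_shift j))

/-- The marked loop of a rooted loop: its root, together with its equivalence class. -/
def RootedLoop.toMarked (f : RootedLoop d β) : MarkedLoop d β :=
  ⟨(f.1.eval 0, Quotient.mk _ f), f, rfl, rfl⟩

theorem RootedLoop.measurable_toMarked :
    Measurable (RootedLoop.toMarked : RootedLoop d β → MarkedLoop d β) :=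
  (((LegPath.measurable_eval 0).comp measurable_subtype_coe).prodMk
    measurable_quotient_mk'').subtype_mk

theorem RootedLoop.toMarked_surjective :
    Function.Surjective (RootedLoop.toMarked : RootedLoop d β → MarkedLoop d β) := by
  rintro ⟨⟨x, l⟩, f, hl, hx⟩
  exact ⟨f, Subtype.ext (Prod.ext hx hl)⟩

theorem RootedLoop.toMarked_eq_iff {f g : RootedLoop d β} :
    f.toMarked = g.toMarked ↔ ∃ j : ℤ, f.periodic (j * β) = f.1.eval 0 ∧ f.shift j = g := by
  have hpair : f.toMarked = g.toMarked ↔ f.1.eval 0 = g.1.eval 0 ∧ f ≈ g :=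
    Subtype.ext_iff.trans (Prod.ext_iff.trans (and_congr Iff.rfl Quotient.eq))
  rw [hpair, RootedLoop.equiv_iff, ← exists_and_left]
  refine exists_congr fun j => and_congr_left ?_
  rintro rfl
  rw [f.eval_shift_zero, eq_comm]

theorem bijOn_toMarked_canonicalLoops :
    BijOn (RootedLoop.toMarked : RootedLoop d β → _) (canonicalLoops d β) univ := by
  refine ⟨mapsTo_univ _ _, fun f hf g hg h => ?_, fun p _ => ?_⟩
  · obtain ⟨i, hi, rfl⟩ := RootedLoop.toMarked_eq_iff.mp h
    obtain ⟨j, hj, hji⟩ := RootedLoop.toMarked_eq_iff.mp h.symm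
    have hle := hg j hj
    rw [hji] at hle
    exact RootedLoop.eq_of_code_eq rfl (le_antisymm (hf i hi) hle)
  · obtain ⟨f, rfl⟩ := RootedLoop.toMarked_surjective p
    obtain ⟨g, ⟨⟨i, rfl⟩, hg⟩, hmin⟩ := exists_min_image
      {g ∈ range f.shift | g.toMarked = f.toMarked} RootedLoop.code
      (f.finite_range_shift.subset (sep_subset _ _))
      ⟨f, ⟨0, f.shift_zero⟩, rfl⟩
    refine ⟨f.shift i, fun j hj => hmin _ ⟨⟨j + i, (f.shift_shift i j).symm⟩, ?_⟩, hg⟩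
    exact (RootedLoop.toMarked_eq_iff.mpr ⟨j, hj, rfl⟩).symm.trans hg

instance : StandardBorelSpace (MarkedLoop d β) := by
  have : MeasurableSpace.CountablySeparated (MarkedLoop d β) :=
    countablySeparated_of_injective (f := fun p => (p.1.1, p.1.2.code))
      ((measurable_fst.prodMk (Loop.measurable_code.comp measurable_snd)).comp
        measurable_subtype_coe)
      fun p q h => Subtype.ext <| Prod.ext (Prod.ext_iff.mp h).1
        (Loop.code_injective (Prod.ext_iff.mp h).2)
  have := (measurableSet_canonicalLoops (d := d) (β := β)).standardBorel
  refine standardBorelSpace_of_bijective (f := (canonicalLoops d β).domRestrict RootedLoop.toMarked)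
    (RootedLoop.measurable_toMarked.comp measurable_subtype_coe) ⟨?_, ?_⟩
  · exact bijOn_toMarked_canonicalLoops.injOn.injective
  · rw [← range_eq_univ, range_domRestrict]
    exact bijOn_toMarked_canonicalLoops.image_eq

theorem measurableSet_allIn {W : Set (Space d)} (hW : MeasurableSet W) :
    MeasurableSet {p : MarkedLoop d β | p.1.2.AllIn W} := by
  have hloop : MeasurableSet {l : Loop d β | l.AllIn W} := by
    refine measurableSet_quotient.mpr ?_
    change MeasurableSet {f : RootedLoop d β | ∀ k : ℤ, f.periodic (k * β) ∈ W}
    simp only [ofPred_forall]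
    exact MeasurableSet.iInter fun k => RootedLoop.measurable_periodic _ hW
  exact measurable_snd.comp measurable_subtype_coe hloop

end Paths

/-! ### Configurations in a box -/

section PointMeasures

variable {X : Type*} [MeasurableSpace X]

theorem pointMeasure_apply (Γ : Set X) {A : Set X} (hA : MeasurableSet A) :
    pointMeasure Γ A = ∑' p : Γ, A.indicator 1 (p : X) :=
  (Measure.sum_apply _ hA).trans (tsum_congr fun _ => Measure.dirac_apply' _ hA)

theorem pointMeasure_singleton [MeasurableSingletonClass X] (Γ : Set X) (x : X) :
    pointMeasure Γ {x} = Γ.indicator 1 x := by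
  classical
  rw [pointMeasure_apply _ (measurableSet_singleton x),
    tsum_subtype Γ (fun p => ({x} : Set X).indicator (1 : X → ENNReal) p),
    tsum_eq_single x fun y hy => by simp [indicator_apply, hy]]
  simp [indicator_apply]

theorem pointMeasure_injective [MeasurableSingletonClass X] :
    Function.Injective (pointMeasure : Set X → Measure X) := fun Γ Γ' h =>
  indicator_one_inj ENNReal <| funext fun x => by
    simp only [← pointMeasure_singleton, h]

theorem pointMeasure_univ_lt_top {Γ : Set X} (hΓ : Γ.Finite) : pointMeasure Γ univ < ⊤ := by
  have := hΓ.fintype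
  rw [pointMeasure_apply _ MeasurableSet.univ, tsum_fintype]
  exact ENNReal.sum_lt_top.mpr fun _ _ => by simp

theorem pointMeasure_range {ι : Type*} [Fintype ι] {v : ι → X} (hv : Function.Injective v)
    {A : Set X} (hA : MeasurableSet A) :
    pointMeasure (range v) A = ∑ i, A.indicator 1 (v i) := by
  rw [pointMeasure_apply _ hA, ← (Equiv.ofInjective v hv).tsum_eq, tsum_fintype]
  rfl

variable [StandardBorelSpace X] {S : Set X}

/-- The finite sequences in `S` that are strictly increasing for the linear order induced by an
embedding of `X` into the real numbers: they enumerate the finite subsets of `S`. -/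
def increasingTuples (S : Set X) : Set (Σ n : ℕ, Fin n → X) :=
  {z | StrictMono (fun i => embeddingReal X (z.2 i)) ∧ ∀ i, z.2 i ∈ S}

theorem measurableSet_increasingTuples (hS : MeasurableSet S) :
    MeasurableSet (increasingTuples S) := by
  refine MeasurableSpace.measurableSet_iInf.mpr fun n => ?_
  change MeasurableSet {v : Fin n → X |
    (∀ i j, i < j → embeddingReal X (v i) < embeddingReal X (v j)) ∧ ∀ i, v i ∈ S}
  have he (i : Fin n) : Measurable fun v : Fin n → X => embeddingReal X (v i) :=
    (measurable_embeddingReal X).comp (measurable_pi_apply i)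
  simp only [ofPred_and, ofPred_forall]
  exact (MeasurableSet.iInter fun i => MeasurableSet.iInter fun j => MeasurableSet.iInter fun _ =>
    measurableSet_lt (he i) (he j)).inter (MeasurableSet.iInter fun i => measurable_pi_apply i hS)

theorem injective_of_mem_increasingTuples {z : Σ n : ℕ, Fin n → X}
    (hz : z ∈ increasingTuples S) : Function.Injective z.2 := fun _ _ h =>
  hz.1.injective (congrArg (embeddingReal X) h)

theorem bijOn_range_increasingTuples (S : Set X) :
    BijOn (fun z : Σ n : ℕ, Fin n → X => range z.2) (increasingTuples S)
      {Γ | Γ.Finite ∧ Γ ⊆ S} := by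
  let _ : LinearOrder X :=
    LinearOrder.lift' (embeddingReal X) (measurableEmbedding_embeddingReal X).injective
  refine ⟨fun z hz => ⟨finite_range _, range_subset_iff.mpr hz.2⟩, ?_, ?_⟩
  · rintro ⟨n, v⟩ hv ⟨m, w⟩ hw (hrange : range v = range w)
    obtain rfl : n = m := by
      have hcard := congrArg (fun Γ : Set X => Nat.card Γ) hrange
      simpa only [Nat.card_range_of_injective (injective_of_mem_increasingTuples hv),
        Nat.card_range_of_injective (injective_of_mem_increasingTuples hw), Nat.card_fin]
        using hcard
    have hvmono : StrictMono v := hv.1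
    have hwmono : StrictMono w := hw.1
    rw [(hvmono.range_inj hwmono).mp hrange]
  · rintro Γ ⟨hΓ, hΓS⟩
    have hrange : range (hΓ.toFinset.orderEmbOfFin rfl) = Γ :=
      (Finset.range_orderEmbOfFin _ rfl).trans hΓ.coe_toFinset
    exact ⟨⟨_, hΓ.toFinset.orderEmbOfFin rfl⟩, ⟨(hΓ.toFinset.orderEmbOfFin rfl).strictMono,
      range_subset_iff.mp (hrange.trans_subset hΓS)⟩, hrange⟩

theorem measurable_pointMeasure_range :
    Measurable fun z : increasingTuples S => pointMeasure (range z.1.2) := by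
  refine Measure.measurable_of_measurable_coe _ fun A hA => ?_
  have hsum : Measurable fun z : Σ n : ℕ, Fin n → X =>
      ∑ i, A.indicator (1 : X → ENNReal) (z.2 i) :=
    measurable_sigma_iff.mpr fun n => Finset.univ.measurable_sum fun i _ =>
      (measurable_one.indicator hA).comp (measurable_pi_apply i)
  simp only [pointMeasure_range (injective_of_mem_increasingTuples (Subtype.prop _)) hA]
  exact hsum.comp measurable_subtype_coe

end PointMeasures

section BoxConfig

variable {d : ℕ} {β : ℝ} [Fact (0 < β)] {W : Set (Space d)}

theorem BoxConfig.ext {b c : BoxConfig β W} (hloops : b.loops = c.loops)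
    (hshreds : b.shreds = c.shreds) : b = c := by
  cases b
  cases c
  congr

theorem BoxConfig.measurable_toMeasures :
    Measurable (BoxConfig.toMeasures : BoxConfig β W → _) :=
  comap_measurable _

theorem BoxConfig.toMeasures_injective :
    Function.Injective (BoxConfig.toMeasures : BoxConfig β W → _) := fun _ _ h =>
  BoxConfig.ext (pointMeasure_injective (Prod.ext_iff.mp h).1)
    (pointMeasure_injective (Prod.ext_iff.mp h).2)

/-- The configuration of the loops and the shreds that a pair of increasing tuples enumerates. -/
def BoxConfig.ofTuples (z : increasingTuples {p : MarkedLoop d β | p.1.2.AllIn W} ×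
    increasingTuples {s : LegPath d β | IsShred W s}) : BoxConfig β W where
  loops := range z.1.1.2
  shreds := range z.2.1.2
  finite_loops := finite_range _
  finite_shreds := finite_range _
  allIn := forall_mem_range.mpr z.1.2.2
  isShred := forall_mem_range.mpr z.2.2.2

theorem BoxConfig.measurable_ofTuples :
    Measurable (BoxConfig.ofTuples : _ → BoxConfig β W) :=
  measurable_comap_iff.mpr ((measurable_pointMeasure_range.comp measurable_fst).prodMk
    (measurable_pointMeasure_range.comp measurable_snd))

theorem BoxConfig.ofTuples_bijective :
    Function.Bijective (BoxConfig.ofTuples : _ → BoxConfig β W) := by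
  refine ⟨fun z w h => Prod.ext ?_ ?_, fun b => ?_⟩
  · exact Subtype.ext ((bijOn_range_increasingTuples _).injOn z.1.2 w.1.2
      (congrArg BoxConfig.loops h))
  · exact Subtype.ext ((bijOn_range_increasingTuples _).injOn z.2.2 w.2.2
      (congrArg BoxConfig.shreds h))
  · obtain ⟨z, hz, hloops⟩ :=
      (bijOn_range_increasingTuples _).surjOn ⟨b.finite_loops, b.allIn⟩
    obtain ⟨w, hw, hshreds⟩ :=
      (bijOn_range_increasingTuples _).surjOn ⟨b.finite_shreds, b.isShred⟩
    exact ⟨(⟨z, hz⟩, ⟨w, hw⟩), BoxConfig.ext hloops hshreds⟩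

theorem BoxConfig.toMeasures_mem (b : BoxConfig β W) :
    b.toMeasures ∈ {μ : Measure (MarkedLoop d β) | μ univ < ⊤} ×ˢ
      {μ : Measure (LegPath d β) | μ univ < ⊤} :=
  ⟨pointMeasure_univ_lt_top b.finite_loops, pointMeasure_univ_lt_top b.finite_shreds⟩

theorem BoxConfig.standardBorelSpace (hW : MeasurableSet W) :
    StandardBorelSpace (BoxConfig β W) := by
  have := countablySeparated_of_injective
    ((measurable_prodMap_distributionCode _ _).comp
      (BoxConfig.measurable_toMeasures (β := β) (W := W)))
    fun b c h => BoxConfig.toMeasures_injective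
      (injOn_prodMap_distributionCode _ _ b.toMeasures_mem c.toMeasures_mem h)
  have := (measurableSet_increasingTuples (measurableSet_allIn (β := β) hW)).standardBorel
  have := (measurableSet_increasingTuples (measurableSet_isShred (β := β) hW)).standardBorel
  exact standardBorelSpace_of_bijective BoxConfig.measurable_ofTuples BoxConfig.ofTuples_bijective

theorem BoxConfig.measurableEmbedding_toMeasures (hW : MeasurableSet W) :
    MeasurableEmbedding (BoxConfig.toMeasures : BoxConfig β W → _) := by
  have := BoxConfig.standardBorelSpace (β := β) hW
  exact measurableEmbedding_of_injOn_comp BoxConfig.measurable_toMeasures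
    (measurable_prodMap_distributionCode _ _)
    ((measurableSet_measure_univ_lt_top _).prod (measurableSet_measure_univ_lt_top _))
    BoxConfig.toMeasures_mem BoxConfig.toMeasures_injective (injOn_prodMap_distributionCode _ _)

end BoxConfig

/-! ### Occurrences of shreds -/

section Occurs

open Filter

variable {d : ℕ} {β : ℝ} {W W' : Set (Space d)}

/-- In both directions of time, `g` has particles outside of `W` that are arbitrarily far away. -/
def Exits (β : ℝ) (W : Set (Space d)) (g : ℝ → Space d) : Prop :=
  (∃ᶠ a : ℤ in atBot, g (a * β) ∉ W) ∧ ∃ᶠ a : ℤ in atTop, g (a * β) ∉ W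

theorem Trajectory.exits {K : Set (Space d)} (hK : IsCompact K) (hW : W ⊆ K)
    (g : Trajectory d β) : Exits β W g.1 := by
  have hfinite : {k : ℤ | g.1 (k * β) ∈ W}.Finite := (g.2 K hK).subset fun k hk => hW hk
  have heventually := hfinite.eventually_cofinite_notMem
  rw [Int.cofinite_eq, eventually_sup] at heventually
  exact ⟨heventually.1.frequently, heventually.2.frequently⟩

theorem exists_last_exit_first_exit {g : ℝ → Space d} (hexits : Exits β W g) {k : ℤ}
    (hk : g (k * β) ∈ W) :
    ∃ a e : ℤ, a < k ∧ k < e ∧ g (a * β) ∉ W ∧ g (e * β) ∉ W ∧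
      ∀ j : ℤ, a < j → j < e → g (j * β) ∈ W := by
  obtain ⟨a, ⟨hak, ha⟩, hamax⟩ := Int.exists_greatest_of_bdd
    (P := fun a => a ≤ k ∧ g (a * β) ∉ W) ⟨k, fun _ h => h.1⟩
    (frequently_atBot.mp hexits.1 k)
  obtain ⟨e, ⟨hke, he⟩, hemin⟩ := Int.exists_least_of_bdd
    (P := fun e => k ≤ e ∧ g (e * β) ∉ W) ⟨k, fun _ h => h.1⟩
    (frequently_atTop.mp hexits.2 k)
  refine ⟨a, e, hak.lt_of_ne (by rintro rfl; exact ha hk),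
    hke.lt_of_ne (by rintro rfl; exact he hk), ha, he, fun j haj hje => ?_⟩
  by_contra hj
  rcases le_total j k with h | h
  · exact haj.not_ge (hamax j ⟨h, hj⟩)
  · exact hje.not_ge (hemin j ⟨h, hj⟩)

variable [hβ : Fact (0 < β)]

theorem LegPath.exits {t : LegPath d β} (hstart : t.eval 0 ∉ W) (hend : t.eval t.duration ∉ W) :
    Exits β W t.eval := by
  refine ⟨Eventually.frequently ((eventually_le_atBot 0).mono fun a ha => ?_),
    Eventually.frequently ((eventually_ge_atTop (t.length : ℤ)).mono fun a ha => ?_)⟩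
  · rwa [t.eval_of_nonpos (mul_nonpos_of_nonpos_of_nonneg (Int.cast_nonpos.mpr ha) hβ.out.le)]
  · rwa [t.eval_of_duration_le (mul_le_mul_of_nonneg_right (by exact_mod_cast ha) hβ.out.le)]

theorem RootedLoop.exits {f : RootedLoop d β} (h : ¬ ∀ k : ℤ, f.periodic (k * β) ∈ W) :
    Exits β W f.periodic := by
  push Not at h
  obtain ⟨k, hk⟩ := h
  have hlength : (0 : ℤ) < f.1.length := by exact_mod_cast f.1.length_pos
  have hperiod (j : ℤ) : f.periodic ((k + j * f.1.length : ℤ) * β) ∉ W := by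
    have hj := f.periodic_duration.int_mul j (k * β)
    rw [LegPath.duration, ← mul_assoc, ← add_mul] at hj
    push_cast
    rwa [hj]
  exact ⟨(tendsto_atBot_add_const_left _ k
      (tendsto_id.atBot_mul_const' hlength)).frequently (.of_forall hperiod),
    (tendsto_atTop_add_const_left _ k
      (tendsto_id.atTop_mul_const' hlength)).frequently (.of_forall hperiod)⟩

theorem IsPiece.eval_sub {g : ℝ → Space d} {a : ℤ} {s : LegPath d β} (h : IsPiece g a s) {u : ℝ}
    (hstart : a * β ≤ u) (hend : u ≤ (a + s.length : ℤ) * β) : s.eval (u - a * β) = g u := by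
  push_cast [add_mul] at hend
  rw [h _ ⟨sub_nonneg.mpr hstart, sub_le_iff_le_add'.mpr hend⟩, add_sub_cancel]

theorem IsPiece.eval_intCast {g : ℝ → Space d} {a : ℤ} {s : LegPath d β} (h : IsPiece g a s) {k : ℤ}
    (hstart : a ≤ k) (hend : k ≤ a + s.length) : s.eval ((k - a : ℤ) * β) = g (k * β) := by
  have hβ₀ := hβ.out.le
  rw [Int.cast_sub, sub_mul]
  exact h.eval_sub (by gcongr) (by gcongr)

/-- The `W`-shred `s` is the piece of `g` that begins at time `aβ`. -/
def Occurs (W : Set (Space d)) (g : ℝ → Space d) (a : ℤ) (s : LegPath d β) : Prop :=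
  IsShred W s ∧ IsPiece g a s

namespace Occurs

variable {g : ℝ → Space d} {a : ℤ} {s : LegPath d β}

theorem two_le_length (h : Occurs W g a s) : (2 : ℤ) ≤ s.length := by exact_mod_cast h.1.1

theorem start_notMem (h : Occurs W g a s) : g (a * β) ∉ W := by
  rw [← h.2.eval_intCast le_rfl (by lia)]
  simpa using h.1.2.1

theorem end_notMem (h : Occurs W g a s) : g ((a + s.length : ℤ) * β) ∉ W := by
  rw [← h.2.eval_intCast (by lia) le_rfl]
  simpa [LegPath.duration] using h.1.2.2.1

theorem mem (h : Occurs W g a s) {k : ℤ} (hstart : a < k) (hend : k < a + s.length) :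
    g (k * β) ∈ W := by
  obtain ⟨j, rfl⟩ := Int.le.dest hstart.le
  rw [← h.2.eval_intCast hstart.le hend.le]
  simpa using h.1.2.2.2 j (by lia) (by lia)

theorem start_unique {b : ℤ} {t : LegPath d β} (hs : Occurs W g a s) (ht : Occurs W g b t) {k : ℤ}
    (hak : a ≤ k) (hka : k < a + s.length) (hbk : b ≤ k) (hkb : k < b + t.length) : a = b := by
  rcases lt_trichotomy a b with h | h | h
  · exact absurd (hs.mem h (by lia)) ht.start_notMem
  · exact h
  · exact absurd (ht.mem h (by lia)) hs.start_notMem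

theorem unique {t : LegPath d β} (hs : Occurs W g a s) (ht : Occurs W g a t) : s = t := by
  have hs₂ := hs.two_le_length
  have ht₂ := ht.two_le_length
  have hlength : s.length = t.length := by
    rcases lt_trichotomy s.length t.length with h | h | h
    · exact absurd (ht.mem (k := a + s.length) (by lia) (by lia)) hs.end_notMem
    · exact h
    · exact absurd (hs.mem (k := a + t.length) (by lia) (by lia)) ht.end_notMem
  refine LegPath.ext hlength fun u hu => ?_
  rw [hs.2 u hu, ht.2 u (by rwa [LegPath.duration, ← hlength])]

theorem congr_piece {g' : ℝ → Space d} {a' : ℤ}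
    (h : ∀ t ∈ Icc 0 s.duration, g (a * β + t) = g' (a' * β + t)) :
    Occurs W g a s ↔ Occurs W g' a' s :=
  and_congr_right fun _ => forall₂_congr fun t ht => by rw [h t ht]

theorem of_eval_iff {t : LegPath d β} {b : ℤ} (ht : IsPiece g a t) (hab : a ≤ b)
    (hba : b + s.length ≤ a + t.length) : Occurs W t.eval (b - a) s ↔ Occurs W g b s := by
  have hβ₀ := hβ.out.le
  refine congr_piece fun u hu => ?_
  have hstart : a * β ≤ b * β + u := le_add_of_le_of_nonneg (by gcongr) hu.1
  have hend : b * β + u ≤ (a + t.length : ℤ) * β :=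
    calc b * β + u ≤ b * β + s.length * β := add_le_add_right hu.2 _
      _ = (b + s.length : ℤ) * β := by push_cast; ring
      _ ≤ (a + t.length : ℤ) * β := by gcongr
  rw [← ht.eval_sub hstart hend, Int.cast_sub, sub_mul, add_sub_right_comm]

theorem window_subset {t : LegPath d β} {b : ℤ} (hstart : t.eval 0 ∉ W)
    (hend : t.eval t.duration ∉ W) (hs : Occurs W t.eval b s) :
    0 ≤ b ∧ b + s.length ≤ t.length := by
  have hs₂ := hs.two_le_length
  constructor
  · by_contra! hb
    have hmem := hs.mem (k := b + 1) (by lia) (by lia)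
    rw [t.eval_of_nonpos (mul_nonpos_of_nonpos_of_nonneg (Int.cast_nonpos.mpr (by lia))
      hβ.out.le)] at hmem
    exact hstart hmem
  · by_contra! hb
    have hmem := hs.mem (k := b + s.length - 1) (by lia) (by lia)
    have hle : (t.length : ℤ) ≤ b + s.length - 1 := by lia
    rw [t.eval_of_duration_le (mul_le_mul_of_nonneg_right (by exact_mod_cast hle) hβ.out.le)]
      at hmem
    exact hend hmem

theorem trans (hW : W ⊆ W') {t : LegPath d β} {b : ℤ} (ht : Occurs W' g a t)
    (hs : Occurs W t.eval (b - a) s) :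
    a ≤ b ∧ b + s.length ≤ a + t.length ∧ Occurs W g b s := by
  obtain ⟨hstart, hend⟩ := hs.window_subset (notMem_subset hW ht.1.2.1)
    (notMem_subset hW ht.1.2.2.1)
  exact ⟨by lia, by lia, (of_eval_iff ht.2 (by lia) (by lia)).mp hs⟩

end Occurs

theorem exists_occurs_of_mem {g : ℝ → Space d} (hg : Continuous g) (hexits : Exits β W g) {k : ℤ}
    (hk : g (k * β) ∈ W) :
    ∃ (a : ℤ) (s : LegPath d β), Occurs W g a s ∧ a < k ∧ k < a + s.length := by
  obtain ⟨a, e, hak, hke, ha, he, hmem⟩ := exists_last_exit_first_exit hexits hk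
  let n : ℕ+ := ⟨(e - a).toNat, by lia⟩
  let s : LegPath d β := LegPath.cut ⟨g, hg⟩ a n
  have hs : IsPiece g a s := LegPath.isPiece_cut ⟨g, hg⟩ a n
  have hlength : (s.length : ℤ) = e - a := Int.toNat_of_nonneg (by lia)
  refine ⟨a, s, ⟨⟨by lia, ?_, ?_, fun j hj hjs => ?_⟩, hs⟩, hak, by lia⟩
  · have heval := hs.eval_intCast le_rfl (by lia)
    rw [sub_self, Int.cast_zero, zero_mul] at heval
    rwa [heval]
  · have heval := hs.eval_intCast (k := e) (by lia) (by lia)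
    rw [← hlength, Int.cast_natCast] at heval
    rwa [LegPath.duration, heval]
  · have heval := hs.eval_intCast (k := a + j) (by lia) (by lia)
    rw [add_sub_cancel_left, Int.cast_natCast] at heval
    rw [heval]
    exact hmem _ (by lia) (by lia)

theorem Occurs.exists_parent {g : ℝ → Space d} (hg : Continuous g) (hWW' : W ⊆ W')
    (hexits : Exits β W' g) {a : ℤ} {s : LegPath d β} (hs : Occurs W g a s) :
    ∃ (b : ℤ) (t : LegPath d β), Occurs W' g b t ∧ Occurs W t.eval (a - b) s := by
  have hs₂ := hs.two_le_length
  obtain ⟨b, t, ht, hba, hat⟩ := exists_occurs_of_mem hg hexits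
    (hWW' (hs.mem (k := a + 1) (by lia) (by lia)))
  have hend : a + s.length ≤ b + t.length := by
    by_contra! h
    exact ht.end_notMem (hWW' (hs.mem (by lia) h))
  exact ⟨b, t, ht, (of_eval_iff ht.2 (by lia) hend).mpr hs⟩

end Occurs

/-! ### Multiplicities of shreds -/

section Discrete

variable {X : Type*} [MeasurableSpace X]

/-- The measure is the sum of its atoms (of which there may be uncountably many). Sums of point
measures have this property even if they are not `σ`-finite. -/
def IsDiscrete (μ : Measure X) : Prop :=
  ∀ A, MeasurableSet A → μ A = ∑' x, A.indicator (fun x => μ {x}) x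

theorem IsDiscrete.ext {μ ν : Measure X} (hμ : IsDiscrete μ) (hν : IsDiscrete ν)
    (h : ∀ x, μ {x} = ν {x}) : μ = ν :=
  Measure.ext fun A hA => by simp only [hμ A hA, hν A hA, h]

theorem IsDiscrete.add {μ ν : Measure X} (hμ : IsDiscrete μ) (hν : IsDiscrete ν) :
    IsDiscrete (μ + ν) := fun A hA => by
  simp only [Measure.add_apply, hμ A hA, hν A hA, ← ENNReal.tsum_add, indicator_add]

variable [MeasurableSingletonClass X]

theorem isDiscrete_pointMeasure (Γ : Set X) : IsDiscrete (pointMeasure Γ) := fun A hA => by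
  simp only [pointMeasure_apply _ hA, tsum_subtype Γ (A.indicator 1), pointMeasure_singleton,
    indicator_indicator, inter_comm Γ]

theorem IsDiscrete.sum {ι : Type*} {μ : ι → Measure X} (h : ∀ i, IsDiscrete (μ i)) :
    IsDiscrete (Measure.sum μ) := fun A hA => by
  simp only [Measure.sum_apply _ hA, Measure.sum_apply _ (measurableSet_singleton _), h _ A hA]
  rw [ENNReal.tsum_comm]
  refine tsum_congr fun x => ?_
  by_cases hx : x ∈ A <;> simp [hx]

theorem IsDiscrete.finsetSum {ι : Type*} {μ : ι → Measure X} (s : Finset ι)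
    (h : ∀ i, IsDiscrete (μ i)) : IsDiscrete (∑ i ∈ s, μ i) := by
  rw [← Measure.sum_coe_finset]
  exact IsDiscrete.sum fun i => h i

end Discrete

section Multiplicities

variable {d : ℕ} {β : ℝ} [hβ : Fact (0 < β)] {W W' : Set (Space d)}

theorem shredAt_singleton_eq_one {g : ℝ → Space d} {a : ℤ} {s : LegPath d β}
    (h : Occurs W g a s) : shredAt W g a {s} = 1 :=
  (pointMeasure_singleton _ s).trans (indicator_of_mem (s := {s | Occurs W g a s}) h 1)

theorem shredAt_singleton_eq_zero {g : ℝ → Space d} {a : ℤ} {s : LegPath d β}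
    (h : ¬ Occurs W g a s) : shredAt W g a {s} = 0 :=
  (pointMeasure_singleton _ s).trans (indicator_of_notMem (s := {s | Occurs W g a s}) h 1)

theorem occurs_of_shredAt_singleton_ne_zero {g : ℝ → Space d} {a : ℤ} {s : LegPath d β}
    (h : shredAt W g a {s} ≠ 0) : Occurs W g a s :=
  not_imp_comm.mp shredAt_singleton_eq_zero h

theorem isDiscrete_shredAt (g : ℝ → Space d) (a : ℤ) :
    IsDiscrete (shredAt W g a : Measure (LegPath d β)) :=
  isDiscrete_pointMeasure _

theorem isDiscrete_pathShreds (s : LegPath d β) : IsDiscrete (pathShreds W s) :=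
  IsDiscrete.sum fun _ => isDiscrete_shredAt _ _

theorem Loop.isDiscrete_shreds (l : Loop d β) : IsDiscrete (l.shreds W) := by
  obtain ⟨f⟩ := l
  exact IsDiscrete.finsetSum _ fun _ => isDiscrete_shredAt _ _

theorem Interlacement.isDiscrete_shreds (g : Interlacement d β) : IsDiscrete (g.shreds W) := by
  obtain ⟨f⟩ := g
  exact IsDiscrete.sum fun _ => isDiscrete_shredAt _ _

theorem pathShreds_singleton (t s : LegPath d β) :
    pathShreds W t {s} = ∑' a : ℤ, shredAt W t.eval a {s} :=
  Measure.sum_apply _ (measurableSet_singleton s)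

theorem Interlacement.shreds_singleton (g : Trajectory d β) (s : LegPath d β) :
    Interlacement.shreds W (Quotient.mk _ g) {s} = ∑' a : ℤ, shredAt W g.1 a {s} :=
  Measure.sum_apply _ (measurableSet_singleton s)

theorem Loop.shreds_singleton (f : RootedLoop d β) (s : LegPath d β) :
    Loop.shreds W (Quotient.mk _ f) {s} =
      ∑ a ∈ Finset.range f.1.length, shredAt W f.periodic (a : ℤ) {s} :=
  Measure.finsetSum_apply _ _ _

theorem shredAt_singleton_eq_tsum {g : ℝ → Space d} (hg : Continuous g) (hWW' : W ⊆ W')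
    (hexits : Exits β W' g) (a : ℤ) (s : LegPath d β) :
    shredAt W g a {s} = ∑' (b : ℤ) (t : LegPath d β),
      shredAt W' g b {t} * shredAt W t.eval (a - b) {s} := by
  by_cases hs : Occurs W g a s
  · obtain ⟨b, t, ht, hst⟩ := hs.exists_parent hg hWW' hexits
    have hs₂ := hs.two_le_length
    have hwindow := ht.trans hWW' hst
    rw [shredAt_singleton_eq_one hs, tsum_eq_single b, tsum_eq_single t,
      shredAt_singleton_eq_one ht, shredAt_singleton_eq_one hst, one_mul]
    · intro t' ht'
      rw [shredAt_singleton_eq_zero fun h => ht' (h.unique ht), zero_mul]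
    · refine fun b' hb' => ENNReal.tsum_eq_zero.mpr fun t' => ?_
      by_contra h
      have ht' := occurs_of_shredAt_singleton_ne_zero (left_ne_zero_of_mul h)
      have hwindow' := ht'.trans hWW'
        (occurs_of_shredAt_singleton_ne_zero (right_ne_zero_of_mul h))
      exact hb' (ht'.start_unique ht (k := a) (by lia) (by lia) (by lia) (by lia))
  · rw [shredAt_singleton_eq_zero hs]
    refine (ENNReal.tsum_eq_zero.mpr fun b => ENNReal.tsum_eq_zero.mpr fun t => ?_).symm
    by_contra h
    exact hs ((occurs_of_shredAt_singleton_ne_zero (left_ne_zero_of_mul h)).trans hWW'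
      (occurs_of_shredAt_singleton_ne_zero (right_ne_zero_of_mul h))).2.2

theorem tsum_shredAt_singleton {g : ℝ → Space d} (hg : Continuous g) (hWW' : W ⊆ W')
    (hexits : Exits β W' g) (s : LegPath d β) :
    ∑' a : ℤ, shredAt W g a {s} = ∑' t : LegPath d β,
      (∑' b : ℤ, shredAt W' g b {t}) * pathShreds W t {s} := by
  simp only [shredAt_singleton_eq_tsum hg hWW' hexits, pathShreds_singleton,
    ← ENNReal.tsum_mul_right]
  rw [ENNReal.tsum_comm, ENNReal.tsum_comm (α := LegPath d β)]
  refine tsum_congr fun b => ?_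
  rw [ENNReal.tsum_comm]
  refine tsum_congr fun t => ?_
  rw [ENNReal.tsum_mul_left]
  exact congrArg _ ((Equiv.subRight b).tsum_eq fun a => shredAt W t.eval a {s})

theorem sum_range_tsum_sub (n : ℕ) (K : ℤ → ℤ → ENNReal) (hK : ∀ a b, K (a + n) b = K a b) :
    ∑ a ∈ Finset.range n, ∑' b : ℤ, K b (a - b) = ∑ a ∈ Finset.range n, ∑' b : ℤ, K a b :=
  calc ∑ a ∈ Finset.range n, ∑' b : ℤ, K b (a - b)
      = ∑ a ∈ Finset.range n, ∑' c : ℤ, K (a - c) c :=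
        Finset.sum_congr rfl fun a _ =>
          ((Equiv.subLeft (a : ℤ)).tsum_eq fun b => K b (a - b)).symm.trans (by simp)
    _ = ∑' c : ℤ, ∑ a ∈ Finset.range n, K (a + -c) c :=
        (Summable.tsum_finsetSum fun _ _ => ENNReal.summable).symm
    _ = ∑' c : ℤ, ∑ a ∈ Finset.range n, K a c :=
        tsum_congr fun c => sum_range_shift n (K · c) (hK · c) (-c)
    _ = ∑ a ∈ Finset.range n, ∑' c : ℤ, K a c :=
        Summable.tsum_finsetSum fun _ _ => ENNReal.summable

theorem RootedLoop.shredAt_add_length (f : RootedLoop d β) (a : ℤ) :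
    (shredAt W f.periodic (a + f.1.length) : Measure (LegPath d β)) = shredAt W f.periodic a :=
  (shredAt_shift W f.periodic f.periodic (f.1.length : ℤ)
    (fun t => by exact_mod_cast (f.periodic_add t).symm) a).symm

theorem Loop.AllIn.mono {l : Loop d β} (h : l.AllIn W) (hW : W ⊆ W') : l.AllIn W' := by
  obtain ⟨f⟩ := l
  exact fun k => hW (h k)

theorem Loop.shreds_singleton_of_allIn {l : Loop d β} (h : l.AllIn W) (s : LegPath d β) :
    l.shreds W {s} = 0 := by
  obtain ⟨f⟩ := l
  exact (Loop.shreds_singleton f s).trans <| Finset.sum_eq_zero fun a _ =>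
    shredAt_singleton_eq_zero fun hs => hs.start_notMem (h a)

theorem Loop.shreds_singleton_eq_tsum (l : Loop d β) (hWW' : W ⊆ W') (hl : ¬ l.AllIn W')
    (s : LegPath d β) :
    l.shreds W {s} = ∑' t, l.shreds W' {t} * pathShreds W t {s} := by
  obtain ⟨f⟩ := l
  change Loop.shreds W (Quotient.mk _ f) {s} =
    ∑' t, Loop.shreds W' (Quotient.mk _ f) {t} * pathShreds W t {s}
  simp only [Loop.shreds_singleton,
    shredAt_singleton_eq_tsum f.continuous_periodic hWW' (RootedLoop.exits hl)]
  rw [sum_range_tsum_sub f.1.length fun a b =>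
    ∑' t : LegPath d β, shredAt W' f.periodic a {t} * shredAt W t.eval b {s}]
  · simp only [Finset.sum_mul, pathShreds_singleton, ← ENNReal.tsum_mul_left]
    rw [Summable.tsum_finsetSum fun _ _ => ENNReal.summable]
    exact Finset.sum_congr rfl fun a _ => ENNReal.tsum_comm
  · simp only [f.shredAt_add_length, implies_true]

theorem pathShreds_singleton_eq_tsum {W'' : Set (Space d)} (hWW' : W ⊆ W') (hW'' : W' ⊆ W'')
    {u : LegPath d β} (hu : IsShred W'' u) (s : LegPath d β) :
    pathShreds W u {s} = ∑' t, pathShreds W' u {t} * pathShreds W t {s} := by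
  rw [pathShreds_singleton, tsum_shredAt_singleton u.continuous_eval hWW'
    (LegPath.exits (notMem_subset hW'' hu.2.1) (notMem_subset hW'' hu.2.2.1))]
  simp only [pathShreds_singleton u]

theorem Interlacement.shreds_singleton_eq_tsum (g : Interlacement d β) (hWW' : W ⊆ W')
    {K : Set (Space d)} (hK : IsCompact K) (hW' : W' ⊆ K) (s : LegPath d β) :
    g.shreds W {s} = ∑' t, g.shreds W' {t} * pathShreds W t {s} := by
  obtain ⟨g⟩ := g
  refine (Interlacement.shreds_singleton g s).trans ?_
  rw [tsum_shredAt_singleton g.1.continuous hWW' (g.exits hK hW')]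
  exact tsum_congr fun t => congrArg (· * _) (Interlacement.shreds_singleton g t).symm

end Multiplicities

section Projections

variable {d : ℕ} {β : ℝ} [Fact (0 < β)] {W W' : Set (Space d)}

/-- The common form of the projections: the loops in `Λ` that have all their particles in `W`, and
the `W`-shreds of the other loops together with those of further objects, which are given by the
measures `o i`. -/
def cutMeasures (W : Set (Space d)) (Λ : Set (MarkedLoop d β)) {ι : Type*}
    (o : ι → Measure (LegPath d β)) : Measure (MarkedLoop d β) × Measure (LegPath d β) :=
  (pointMeasure {p ∈ Λ | p.1.2.AllIn W},
    (Measure.sum fun p : Λ => p.1.1.2.shreds W) + Measure.sum o)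

theorem cutMeasures_snd_singleton (Λ : Set (MarkedLoop d β)) {ι : Type*}
    (o : ι → Measure (LegPath d β)) (s : LegPath d β) :
    (cutMeasures W Λ o).2 {s} = ∑' p : Λ, p.1.1.2.shreds W {s} + ∑' i, o i {s} := by
  simp only [cutMeasures, Measure.add_apply, Measure.sum_apply _ (measurableSet_singleton s)]

theorem isDiscrete_cutMeasures_snd (Λ : Set (MarkedLoop d β)) {ι : Type*}
    {o : ι → Measure (LegPath d β)} (ho : ∀ i, IsDiscrete (o i)) :
    IsDiscrete (cutMeasures W Λ o).2 :=
  .add (.sum fun _ => Loop.isDiscrete_shreds _) (.sum ho)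

theorem tsum_loop_shreds_singleton (hWW' : W ⊆ W') (Λ : Set (MarkedLoop d β)) (s : LegPath d β) :
    ∑' p : Λ, p.1.1.2.shreds W {s} =
      ∑' p : {p ∈ Λ | p.1.2.AllIn W'}, p.1.1.2.shreds W {s} +
        ∑' p : Λ, ∑' t, p.1.1.2.shreds W' {t} * pathShreds W t {s} := by
  classical
  rw [tsum_subtype Λ fun p => p.1.2.shreds W {s}, tsum_subtype {p ∈ Λ | p.1.2.AllIn W'}
    fun p => p.1.2.shreds W {s}, tsum_subtype Λ fun p =>
      ∑' t, p.1.2.shreds W' {t} * pathShreds W t {s}, ← ENNReal.tsum_add]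
  refine tsum_congr fun p => ?_
  by_cases hp : p.1.2.AllIn W'
  · simp [indicator_apply, hp, Loop.shreds_singleton_of_allIn hp]
  · simp [indicator_apply, hp, p.1.2.shreds_singleton_eq_tsum hWW' hp s]

theorem tsum_pathShreds_singleton (Γ : Set (LegPath d β)) (s : LegPath d β) :
    ∑' t : Γ, pathShreds W (t : LegPath d β) {s} =
      ∑' t, pointMeasure Γ {t} * pathShreds W t {s} := by
  classical
  rw [tsum_subtype Γ fun t => pathShreds W t {s}]
  simp [pointMeasure_singleton, indicator_apply]

theorem cutMeasures_eq_proj (hWW' : W ⊆ W') (Λ : Set (MarkedLoop d β)) {ι : Type*}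
    {o o' : ι → Measure (LegPath d β)} (hdiscrete : ∀ i, IsDiscrete (o i))
    (ho : ∀ i s, o i {s} = ∑' t, o' i {t} * pathShreds W t {s}) {b : BoxConfig β W'}
    (h : cutMeasures W' Λ o' = b.toMeasures) : cutMeasures W Λ o = b.proj W := by
  have hloops : {p ∈ Λ | p.1.2.AllIn W'} = b.loops :=
    pointMeasure_injective (Prod.ext_iff.mp h).1
  have hshreds (t : LegPath d β) : (∑' p : Λ, p.1.1.2.shreds W' {t}) + ∑' i, o' i {t} =
      pointMeasure b.shreds {t} := by
    rw [← cutMeasures_snd_singleton, h]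
    rfl
  refine Prod.ext (congrArg pointMeasure (Set.ext fun p => ?_)) <|
    IsDiscrete.ext (isDiscrete_cutMeasures_snd Λ hdiscrete)
      (isDiscrete_cutMeasures_snd b.loops fun _ => isDiscrete_pathShreds _) fun s => ?_
  · rw [← hloops]
    exact ⟨fun hp => ⟨⟨hp.1, hp.2.mono hWW'⟩, hp.2⟩, fun hp => ⟨hp.1.1, hp.2⟩⟩
  · refine (cutMeasures_snd_singleton Λ _ s).trans
      (Eq.trans ?_ (cutMeasures_snd_singleton b.loops _ s).symm)
    rw [tsum_loop_shreds_singleton hWW', hloops, tsum_pathShreds_singleton, add_assoc]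
    congr 1
    simp only [ho]
    rw [ENNReal.tsum_comm, ENNReal.tsum_comm (α := ι), ← ENNReal.tsum_add]
    refine tsum_congr fun t => ?_
    rw [ENNReal.tsum_mul_right, ENNReal.tsum_mul_right, ← add_mul, hshreds]

theorem Config.proj_eq_proj (hWW' : W ⊆ W') {K : Set (Space d)} (hK : IsCompact K) (hW' : W' ⊆ K)
    {c : Config d β} {b : BoxConfig β W'} (h : c.proj W' = b.toMeasures) : c.proj W = b.proj W :=
  cutMeasures_eq_proj hWW' c.loops (fun g : c.interlacements => g.1.isDiscrete_shreds)
    (fun g s => g.1.shreds_singleton_eq_tsum hWW' hK hW' s) h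

theorem BoxConfig.proj_eq_proj {W'' : Set (Space d)} (hWW' : W ⊆ W') (hW'' : W' ⊆ W'')
    {c : BoxConfig β W''} {b : BoxConfig β W'} (h : c.proj W' = b.toMeasures) :
    c.proj W = b.proj W :=
  cutMeasures_eq_proj hWW' c.loops (fun _ : c.shreds => isDiscrete_pathShreds _)
    (fun u s => pathShreds_singleton_eq_tsum hWW' hW'' (c.isShred u u.2) s) h

end Projections

/-! ### Consistent sequences of configurations -/

theorem eq_of_tsum_le_one {ι : Type*} {f : ι → ENNReal} (hf : ∑' i, f i ≤ 1) {i j : ι}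
    (hi : 1 ≤ f i) (hj : 1 ≤ f j) : i = j := by
  classical
  by_contra hij
  have hpair : f i + f j ≤ 1 := by
    rw [← Finset.sum_pair hij]
    exact (ENNReal.sum_le_tsum {i, j}).trans hf
  have htwo := (add_le_add hi hj).trans hpair
  norm_num at htwo

section NonzeroMultiplicities

variable {d : ℕ} {β : ℝ} [hβ : Fact (0 < β)] {W : Set (Space d)} {s : LegPath d β}

theorem tsum_shredAt_singleton_ne_zero_iff {g : ℝ → Space d} :
    ∑' a : ℤ, shredAt W g a {s} ≠ 0 ↔ ∃ a, Occurs W g a s := by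
  rw [Ne, ENNReal.tsum_eq_zero, not_forall]
  exact exists_congr fun a => ⟨occurs_of_shredAt_singleton_ne_zero, fun h =>
    (shredAt_singleton_eq_one h).trans_ne one_ne_zero⟩

theorem pathShreds_singleton_ne_zero_iff {t : LegPath d β} :
    pathShreds W t {s} ≠ 0 ↔ ∃ a, Occurs W t.eval a s := by
  rw [pathShreds_singleton, tsum_shredAt_singleton_ne_zero_iff]

theorem Interlacement.shreds_singleton_ne_zero_iff {g : Trajectory d β} :
    Interlacement.shreds W (Quotient.mk _ g) {s} ≠ 0 ↔ ∃ a, Occurs W g.1 a s := by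
  rw [Interlacement.shreds_singleton, tsum_shredAt_singleton_ne_zero_iff]

theorem one_le_pathShreds_singleton {t : LegPath d β} {a : ℤ} (h : Occurs W t.eval a s) :
    1 ≤ pathShreds W t {s} := by
  rw [pathShreds_singleton, ← shredAt_singleton_eq_one h]
  exact ENNReal.le_tsum (f := fun a : ℤ => shredAt W t.eval a {s}) a

theorem Loop.one_le_shreds_singleton {l : Loop d β} (h : l.shreds W {s} ≠ 0) :
    1 ≤ l.shreds W {s} := by
  obtain ⟨f⟩ := l
  obtain ⟨a, ha, hs⟩ := Finset.exists_ne_zero_of_sum_ne_zero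
    ((Loop.shreds_singleton f s).symm.trans_ne h)
  calc 1 = shredAt W f.periodic a {s} :=
        (shredAt_singleton_eq_one (occurs_of_shredAt_singleton_ne_zero hs)).symm
    _ ≤ ∑ a ∈ Finset.range f.1.length, shredAt W f.periodic (a : ℤ) {s} :=
        Finset.single_le_sum (f := fun a : ℕ => shredAt W f.periodic (a : ℤ) {s})
          (fun _ _ => zero_le) ha
    _ = _ := (Loop.shreds_singleton f s).symm

theorem Loop.shreds_singleton_ne_zero_of_occurs {f : RootedLoop d β} {a : ℤ}
    (h : Occurs W f.periodic a s) : Loop.shreds W (Quotient.mk _ f) {s} ≠ 0 := by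
  rw [Loop.shreds_singleton, ← sum_range_shift f.1.length
    (fun a => shredAt W f.periodic a {s}) (fun a => by rw [f.shredAt_add_length]) a]
  refine fun hsum => one_ne_zero ((shredAt_singleton_eq_one h).symm.trans ?_)
  simpa using Finset.sum_eq_zero_iff.mp hsum 0 (Finset.mem_range.mpr f.1.length_pos)

theorem MarkedLoop.exists_shreds_singleton_ne_zero {p : MarkedLoop d β} (hp : p.1.1 ∈ W)
    (hW : ¬ p.1.2.AllIn W) : ∃ s, p.1.2.shreds W {s} ≠ 0 := by
  obtain ⟨⟨x, l⟩, f, hl, hx⟩ := p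
  obtain rfl : ⟦f⟧ = l := hl
  obtain rfl : f.1.eval 0 = x := hx
  obtain ⟨a, s, hs, -⟩ := exists_occurs_of_mem (k := 0) f.continuous_periodic
    (RootedLoop.exits (W := W) hW) (by simpa [f.periodic_zero] using hp)
  exact ⟨s, Loop.shreds_singleton_ne_zero_of_occurs hs⟩

end NonzeroMultiplicities

section Consistent

variable {d : ℕ} {β : ℝ} [hβ : Fact (0 < β)] {W : CompactExhaustion (Space d)}

/-- The configurations in the windows `W 0 ⊆ W 1 ⊆ ⋯` are mapped to each other by the
projections. -/
def Consistent (b : ∀ n, BoxConfig β (W n)) : Prop :=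
  ∀ n, (b (n + 1)).proj (W n) = (b n).toMeasures

namespace Consistent

variable {b : ∀ n, BoxConfig β (W n)} (hb : Consistent b) {n N : ℕ} (hnN : n < N)
  {s : LegPath d β}

include hb hnN

theorem proj_eq : (b N).proj (W n) = (b n).toMeasures := by
  induction N, hnN using Nat.le_induction with
  | base => exact hb n
  | succ N hN ih =>
    exact (BoxConfig.proj_eq_proj (W.subset (Nat.le_of_succ_le hN)) (W.subset N.le_succ)
      (hb N)).trans ih

theorem loops_allIn_eq : {p ∈ (b N).loops | p.1.2.AllIn (W n)} = (b n).loops :=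
  pointMeasure_injective (Prod.ext_iff.mp (hb.proj_eq hnN)).1

theorem multiplicity_eq (s : LegPath d β) :
    ∑' p : (b N).loops, p.1.1.2.shreds (W n) {s} +
      ∑' t : (b N).shreds, pathShreds (W n) (t : LegPath d β) {s} =
      (b n).shreds.indicator 1 s := by
  have hshreds : ((b N).proj (W n)).2 {s} = pointMeasure (b n).shreds {s} := by
    rw [hb.proj_eq hnN]
    rfl
  rw [← pointMeasure_singleton, ← hshreds]
  exact (cutMeasures_snd_singleton (b N).loops _ s).symm

theorem multiplicity_le_one (s : LegPath d β) :
    ∑' p : (b N).loops, p.1.1.2.shreds (W n) {s} +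
      ∑' t : (b N).shreds, pathShreds (W n) (t : LegPath d β) {s} ≤ 1 := by
  rw [hb.multiplicity_eq hnN s]
  exact indicator_apply_le' (fun _ => le_rfl) fun _ => zero_le

theorem mem_shreds_of_loop {p : MarkedLoop d β} (hp : p ∈ (b N).loops)
    (hs : p.1.2.shreds (W n) {s} ≠ 0) : s ∈ (b n).shreds := by
  by_contra hsn
  have hzero := hb.multiplicity_eq hnN s
  rw [indicator_of_notMem hsn, add_eq_zero] at hzero
  exact hs (ENNReal.tsum_eq_zero.mp hzero.1 ⟨p, hp⟩)

theorem mem_shreds_of_occurs {t : LegPath d β} (ht : t ∈ (b N).shreds) {a : ℤ}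
    (hs : Occurs (W n) t.eval a s) : s ∈ (b n).shreds := by
  by_contra hsn
  have hzero := hb.multiplicity_eq hnN s
  rw [indicator_of_notMem hsn, add_eq_zero] at hzero
  exact pathShreds_singleton_ne_zero_iff.mpr ⟨a, hs⟩ (ENNReal.tsum_eq_zero.mp hzero.2 ⟨t, ht⟩)

theorem loop_unique {p p' : MarkedLoop d β} (hp : p ∈ (b N).loops) (hp' : p' ∈ (b N).loops)
    (hs : p.1.2.shreds (W n) {s} ≠ 0) (hs' : p'.1.2.shreds (W n) {s} ≠ 0) : p = p' :=
  congrArg Subtype.val <|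
    eq_of_tsum_le_one (le_self_add.trans (hb.multiplicity_le_one hnN s)) (i := ⟨p, hp⟩)
      (j := ⟨p', hp'⟩) (Loop.one_le_shreds_singleton hs) (Loop.one_le_shreds_singleton hs')

theorem loop_shreds_eq_one {p : MarkedLoop d β} (hp : p ∈ (b N).loops)
    (hs : p.1.2.shreds (W n) {s} ≠ 0) : p.1.2.shreds (W n) {s} = 1 := by
  refine le_antisymm ?_ (Loop.one_le_shreds_singleton hs)
  calc p.1.2.shreds (W n) {s}
      ≤ ∑' p : (b N).loops, p.1.1.2.shreds (W n) {s} :=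
        ENNReal.le_tsum (f := fun p : (b N).loops => p.1.1.2.shreds (W n) {s}) ⟨p, hp⟩
    _ ≤ 1 := le_self_add.trans (hb.multiplicity_le_one hnN s)

theorem occurs_unique {t t' : LegPath d β} (ht : t ∈ (b N).shreds) (ht' : t' ∈ (b N).shreds)
    {a a' : ℤ} (hs : Occurs (W n) t.eval a s) (hs' : Occurs (W n) t'.eval a' s) :
    t = t' ∧ a = a' := by
  have hle := le_add_self.trans (hb.multiplicity_le_one hnN s)
  simp only [pathShreds_singleton] at hle
  rw [← ENNReal.tsum_prod (f := fun (t : (b N).shreds) a =>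
    shredAt (W n) (t : LegPath d β).eval a {s})] at hle
  have heq := eq_of_tsum_le_one hle (i := (⟨t, ht⟩, a)) (j := (⟨t', ht'⟩, a'))
    (shredAt_singleton_eq_one hs).ge (shredAt_singleton_eq_one hs').ge
  simpa using heq

theorem loop_shreds_eq_zero_of_occurs {t : LegPath d β} (ht : t ∈ (b N).shreds) {a : ℤ}
    (hs : Occurs (W n) t.eval a s) {p : MarkedLoop d β} (hp : p ∈ (b N).loops) :
    p.1.2.shreds (W n) {s} = 0 := by
  by_contra hps
  have hloop : 1 ≤ ∑' p : (b N).loops, p.1.1.2.shreds (W n) {s} :=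
    (Loop.one_le_shreds_singleton hps).trans
      (ENNReal.le_tsum (f := fun p : (b N).loops => p.1.1.2.shreds (W n) {s}) ⟨p, hp⟩)
  have hshred : 1 ≤ ∑' t : (b N).shreds, pathShreds (W n) (t : LegPath d β) {s} :=
    (one_le_pathShreds_singleton hs).trans
      (ENNReal.le_tsum (f := fun t : (b N).shreds => pathShreds (W n) t.1 {s}) ⟨t, ht⟩)
  have htwo := (add_le_add hloop hshred).trans (hb.multiplicity_le_one hnN s)
  norm_num at htwo

theorem exists_occurs (hs : s ∈ (b n).shreds)
    (hloops : ∀ p ∈ (b N).loops, p.1.2.shreds (W n) {s} = 0) :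
    ∃ t ∈ (b N).shreds, ∃ a, Occurs (W n) t.eval a s := by
  have hone := hb.multiplicity_eq hnN s
  rw [ENNReal.tsum_eq_zero.mpr fun p : (b N).loops => hloops p p.2, zero_add,
    indicator_of_mem hs] at hone
  obtain ⟨t, ht⟩ := not_forall.mp
    (mt ENNReal.tsum_eq_zero.mpr (hone.trans_ne one_ne_zero))
  exact ⟨t, t.2, pathShreds_singleton_ne_zero_iff.mp ht⟩

theorem occurs_of_occurs {N' : ℕ} (hNN' : N < N') {t t' : LegPath d β} (ht : t ∈ (b N).shreds)
    (ht' : t' ∈ (b N').shreds) {a a' : ℤ} (hs : Occurs (W n) t.eval a s)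
    (hs' : Occurs (W n) t'.eval a' s) : Occurs (W N) t'.eval (a' - a) t := by
  have hexits : Exits β (W N) t'.eval :=
    have hshred := (b N').isShred t' ht'
    LegPath.exits (notMem_subset (W.subset hNN'.le) hshred.2.1)
      (notMem_subset (W.subset hNN'.le) hshred.2.2.1)
  obtain ⟨c, u, hu, hsu⟩ := hs'.exists_parent t'.continuous_eval (W.subset hnN.le) hexits
  obtain ⟨rfl, rfl⟩ :=
    hb.occurs_unique hnN ht (hb.mem_shreds_of_occurs hNN' ht' hu) hs hsu
  rwa [sub_sub_cancel]

end Consistent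

theorem Consistent.loops_mono {b : ∀ n, BoxConfig β (W n)} (hb : Consistent b) :
    Monotone fun n => (b n).loops :=
  monotone_nat_of_le_succ fun n =>
    (hb.loops_allIn_eq n.lt_succ_self).symm.subset.trans (sep_subset _ _)

end Consistent

/-! ### Gluing shreds to interlacements -/

section Tower

open Filter Topology

theorem tendsto_atTop_of_monotone_of_exists_lt {ι : Type*} [Preorder ι] [Nonempty ι] {f : ι → ℤ}
    (hf : Monotone f) (hlt : ∀ i, ∃ j, f i < f j) : Tendsto f atTop atTop := by
  refine tendsto_atTop_atTop_of_monotone' hf fun hbdd => ?_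
  obtain ⟨i, hi⟩ := Int.csSup_mem (range_nonempty f) hbdd
  obtain ⟨j, hij⟩ := hlt i
  exact (hi ▸ hij).not_ge (le_csSup hbdd (mem_range_self j))

variable {d : ℕ} {β : ℝ} [hβ : Fact (0 < β)] {V : ℕ → Set (Space d)} {A : ℕ → ℤ}
  {t : ℕ → LegPath d β}

/-- For every `k`, if the paths `t m` are placed at times `A m`, then `t k` is the `V k`-shred at
time `A k` of all the later ones. -/
def IsTower (V : ℕ → Set (Space d)) (A : ℕ → ℤ) (t : ℕ → LegPath d β) : Prop :=
  ∀ ⦃k m⦄, k < m → Occurs (V k) (t m).eval (A k - A m) (t k)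

namespace IsTower

theorem isShred (h : IsTower V A t) (k : ℕ) : IsShred (V k) (t k) := (h k.lt_succ_self).1

theorem window_subset (h : IsTower V A t) (hV : Monotone V) {k m : ℕ} (hkm : k < m) :
    A m ≤ A k ∧ A k + (t k).length ≤ A m + (t m).length := by
  have hshred := h.isShred m
  obtain ⟨hstart, hend⟩ := (h hkm).window_subset (notMem_subset (hV hkm.le) hshred.2.1)
    (notMem_subset (hV hkm.le) hshred.2.2.1)
  exact ⟨by lia, by lia⟩

theorem start_lt (h : IsTower V A t) (hV : Monotone V) {k m : ℕ} (hkm : k < m)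
    (hmem : (t k).eval 0 ∈ V m) : A m < A k := by
  refine (h.window_subset hV hkm).1.lt_of_ne fun heq => (h.isShred m).2.1 ?_
  have heval := (h hkm).2.eval_intCast le_rfl (by lia)
  rw [heq, sub_self, sub_self, Int.cast_zero, zero_mul] at heval
  rwa [← heval]

theorem end_lt (h : IsTower V A t) (hV : Monotone V) {k m : ℕ} (hkm : k < m)
    (hmem : (t k).eval (t k).duration ∈ V m) :
    A k + (t k).length < A m + (t m).length := by
  refine (h.window_subset hV hkm).2.lt_of_ne fun heq => (h.isShred m).2.2.1 ?_
  have heval := (h hkm).2.eval_intCast (k := (t m).length) (by lia) (by lia)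
  have hlength : ((t m).length : ℤ) - (A k - A m) = (t k).length := by lia
  rw [hlength, Int.cast_natCast, Int.cast_natCast] at heval
  exact heval ▸ hmem

theorem tendsto_start (h : IsTower V A t) (hV : Monotone V) (hcover : ⋃ k, V k = univ) :
    Tendsto A atTop atBot := by
  refine tendsto_neg_atTop_iff.mp (tendsto_atTop_of_monotone_of_exists_lt
    (monotone_nat_of_le_succ fun k => neg_le_neg (h.window_subset hV k.lt_succ_self).1) fun k => ?_)
  obtain ⟨N, hN⟩ := mem_iUnion.mp (hcover.symm.subset (mem_univ ((t k).eval 0)))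
  exact ⟨max N (k + 1), neg_lt_neg
    (h.start_lt hV (le_max_right N (k + 1)) (hV (le_max_left N (k + 1)) hN))⟩

theorem tendsto_end (h : IsTower V A t) (hV : Monotone V) (hcover : ⋃ k, V k = univ) :
    Tendsto (fun k => A k + (t k).length) atTop atTop := by
  refine tendsto_atTop_of_monotone_of_exists_lt
    (monotone_nat_of_le_succ fun k => (h.window_subset hV k.lt_succ_self).2) fun k => ?_
  obtain ⟨N, hN⟩ := mem_iUnion.mp (hcover.symm.subset (mem_univ ((t k).eval (t k).duration)))
  exact ⟨max N (k + 1),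
    h.end_lt hV (le_max_right N (k + 1)) (hV (le_max_left N (k + 1)) hN)⟩

theorem eval_eq (h : IsTower V A t) {k m : ℕ} (hkm : k ≤ m) {x : ℝ}
    (hx : x ∈ Icc (A k * β) ((A k + (t k).length : ℤ) * β)) :
    (t m).eval (x - A m * β) = (t k).eval (x - A k * β) := by
  obtain rfl | hkm := hkm.eq_or_lt
  · rfl
  have heval := (h hkm).2.eval_sub (u := x - A m * β)
  push_cast [add_mul, sub_mul] at heval hx
  rw [← heval (by linarith [hx.1]) (by linarith [hx.2])]
  congr 1
  ring

theorem exists_glue (h : IsTower V A t) (hV : Monotone V) (hcover : ⋃ k, V k = univ) :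
    ∃ g : C(ℝ, Space d), ∀ k, Occurs (V k) g (A k) (t k) := by
  let S (k : ℕ) : Set ℝ := Icc (A k * β) ((A k + (t k).length : ℤ) * β)
  let φ (k : ℕ) : C(S k, Space d) :=
    ⟨fun x => (t k).eval (x - A k * β), (t k).continuous_eval.comp (by fun_prop)⟩
  have hφ (k m : ℕ) (x : ℝ) (hxk : x ∈ S k) (hxm : x ∈ S m) : φ k ⟨x, hxk⟩ = φ m ⟨x, hxm⟩ := by
    rcases le_total k m with hkm | hmk
    · exact (h.eval_eq hkm hxk).symm
    · exact h.eval_eq hmk hxm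
  have hS (x : ℝ) : ∃ k, S k ∈ 𝓝 x := by
    have hstart := ((tendsto_intCast_atBot_iff (R := ℝ)).mpr (h.tendsto_start hV hcover)
      ).atBot_mul_const hβ.out |>.eventually_lt_atBot x
    have hend := ((tendsto_intCast_atTop_iff (R := ℝ)).mpr (h.tendsto_end hV hcover)
      ).atTop_mul_const hβ.out |>.eventually_gt_atTop x
    obtain ⟨k, hstart, hend⟩ := (hstart.and hend).exists
    exact ⟨k, Icc_mem_nhds hstart hend⟩
  refine ⟨ContinuousMap.liftCover S φ hφ hS, fun k => ⟨h.isShred k, fun u hu => ?_⟩⟩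
  have hmem : A k * β + u ∈ S k := by
    refine ⟨le_add_of_nonneg_right hu.1, ?_⟩
    push_cast [add_mul]
    exact add_le_add_right hu.2 _
  refine Eq.trans ?_ (ContinuousMap.liftCover_coe (hφ := hφ) (hS := hS) (⟨_, hmem⟩ : S k)).symm
  exact congrArg (t k).eval (add_sub_cancel_left _ _).symm

end IsTower

end Tower

section Fits

open Filter

variable {d : ℕ} {β : ℝ} [hβ : Fact (0 < β)] {W : CompactExhaustion (Space d)}
  {b : ∀ n, BoxConfig β (W n)}

/-- All the shreds of `g` belong to the given configurations. -/
structure Fits (b : ∀ n, BoxConfig β (W n)) (g : ℝ → Space d) : Prop where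
  continuous : Continuous g
  exits : ∀ n, Exits β (W n) g
  mem_shreds : ∀ n a s, Occurs (W n) g a s → s ∈ (b n).shreds

namespace Fits

variable {g g' : ℝ → Space d}

theorem eventually_exists_window (hg : Fits b g) {k l : ℤ} (hkl : k ≤ l) :
    ∀ᶠ N in atTop, ∃ (a : ℤ) (t : LegPath d β), Occurs (W N) g a t ∧ a < k ∧ l < a + t.length := by
  obtain ⟨N₀, hN₀⟩ := W.exists_superset_of_isCompact
    ((finite_Icc k l).image fun i : ℤ => g (i * β)).isCompact
  filter_upwards [eventually_ge_atTop N₀] with N hN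
  have hmem (i : ℤ) (hi : i ∈ Icc k l) : g (i * β) ∈ W N :=
    W.subset hN (hN₀ (mem_image_of_mem _ hi))
  obtain ⟨a, t, ht, hak, hka⟩ := exists_occurs_of_mem hg.continuous (hg.exits N)
    (hmem k ⟨le_rfl, hkl⟩)
  refine ⟨a, t, ht, hak, ?_⟩
  by_contra! hend
  exact ht.end_notMem (hmem _ ⟨hka.le, hend⟩)

theorem occurs_unique (hb : Consistent b) (hg : Fits b g) {n : ℕ} {a a' : ℤ} {s : LegPath d β}
    (hs : Occurs (W n) g a s) (hs' : Occurs (W n) g a' s) : a = a' := by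
  obtain ⟨N, ⟨A, t, ht, hA, hA'⟩, hnN⟩ :=
    ((hg.eventually_exists_window (k := min a a') (l := max (a + s.length) (a' + s.length))
      (by lia)).and (eventually_gt_atTop n)).exists
  have htb := hg.mem_shreds N A t ht
  have heq := (hb.occurs_unique hnN htb htb
    ((Occurs.of_eval_iff ht.2 (by lia) (by lia)).mpr hs)
    ((Occurs.of_eval_iff ht.2 (by lia) (by lia)).mpr hs')).2
  lia

theorem eventually_exists_parent (hg : Fits b g) {n : ℕ} {a : ℤ} {s : LegPath d β}
    (hs : Occurs (W n) g a s) (x : ℝ) :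
    ∀ᶠ N in atTop, ∃ t ∈ (b N).shreds, ∃ c : ℤ,
      Occurs (W n) t.eval c s ∧ t.eval (x + c * β) = g (x + a * β) := by
  have hfloor : ⌊x / β⌋ * β ≤ x := (le_div_iff₀ hβ.out).mp (Int.floor_le _)
  have hceil : x ≤ ⌈x / β⌉ * β := (div_le_iff₀ hβ.out).mp (Int.le_ceil _)
  have hle := Int.floor_le_ceil (x / β)
  filter_upwards [hg.eventually_exists_window (k := a + min 0 ⌊x / β⌋)
    (l := a + max (s.length : ℤ) ⌈x / β⌉) (by lia)] with N hN
  obtain ⟨A, t, ht, hA, hA'⟩ := hN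
  refine ⟨t, hg.mem_shreds N A t ht, a - A,
    (Occurs.of_eval_iff ht.2 (by lia) (by lia)).mpr hs, ?_⟩
  have hβ₀ := hβ.out.le
  have hstart : (A : ℝ) * β ≤ x + a * β :=
    calc (A : ℝ) * β ≤ (⌊x / β⌋ + a : ℤ) * β := by gcongr; lia
      _ = ⌊x / β⌋ * β + a * β := by push_cast; ring
      _ ≤ x + a * β := by gcongr
  have hend : x + a * β ≤ (A + t.length : ℤ) * β :=
    calc x + a * β ≤ ⌈x / β⌉ * β + a * β := by gcongr
      _ = (⌈x / β⌉ + a : ℤ) * β := by push_cast; ring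
      _ ≤ (A + t.length : ℤ) * β :=
        mul_le_mul_of_nonneg_right (Int.cast_le.mpr (by lia)) hβ₀
  rw [← ht.2.eval_sub hstart hend, Int.cast_sub, sub_mul, add_sub_assoc]

theorem eq_of_occurs (hb : Consistent b) (hg : Fits b g) (hg' : Fits b g') {n : ℕ} {a a' : ℤ}
    {s : LegPath d β} (hs : Occurs (W n) g a s) (hs' : Occurs (W n) g' a' s) (x : ℝ) :
    g (x + a * β) = g' (x + a' * β) := by
  obtain ⟨N, ⟨⟨t, ht, c, hst, hx⟩, t', ht', c', hst', hx'⟩, hnN⟩ :=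
    (((hg.eventually_exists_parent hs x).and (hg'.eventually_exists_parent hs' x)).and
      (eventually_gt_atTop n)).exists
  obtain ⟨rfl, rfl⟩ := hb.occurs_unique hnN ht ht' hst hst'
  exact hx.symm.trans hx'

theorem finite_particles (hb : Consistent b) (hg : Fits b g) {K : Set (Space d)}
    (hK : IsCompact K) : {k : ℤ | g (k * β) ∈ K}.Finite := by
  obtain ⟨m, hm⟩ := W.exists_superset_of_isCompact hK
  have hfinite : (⋃ s ∈ (b m).shreds, ⋃ a ∈ {a | Occurs (W m) g a s},
      Ioo a (a + s.length)).Finite :=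
    (b m).finite_shreds.biUnion fun s _ =>
      (Set.Subsingleton.finite fun _ ha _ ha' => hg.occurs_unique hb ha ha').biUnion
        fun a _ => finite_Ioo _ _
  refine hfinite.subset fun k hk => ?_
  obtain ⟨a, s, hs, hwindow⟩ := exists_occurs_of_mem hg.continuous (hg.exits m) (hm hk)
  exact mem_biUnion (hg.mem_shreds m a s hs) (mem_biUnion (s := {a | _}) hs hwindow)

end Fits

theorem Trajectory.fits {g : Trajectory d β}
    (hg : ∀ n s, Interlacement.shreds (W n) (Quotient.mk _ g) {s} ≠ 0 → s ∈ (b n).shreds) :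
    Fits b g.1 :=
  ⟨g.1.continuous, fun n => g.exits (W.isCompact n) subset_rfl,
    fun n a s hs => hg n s (Interlacement.shreds_singleton_ne_zero_iff.mpr ⟨a, hs⟩)⟩

theorem Consistent.exists_isTower (hb : Consistent b) {n : ℕ} {s : LegPath d β}
    (hs : s ∈ (b n).shreds)
    (hloops : ∀ N > n, ∀ p ∈ (b N).loops, p.1.2.shreds (W n) {s} = 0) :
    ∃ A t, IsTower (β := β) (fun k => W (n + 1 + k)) A t ∧ ∀ k,
      t k ∈ (b (n + 1 + k)).shreds ∧ Occurs (W n) (t k).eval (0 - A k) s := by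
  have hlt (k : ℕ) : n < n + 1 + k := by lia
  choose t ht c hc using fun k => hb.exists_occurs (hlt k) hs (hloops _ (hlt k))
  refine ⟨fun k => -c k, t, fun k m hkm => ?_, fun k => ⟨ht k, by simpa using hc k⟩⟩
  rw [neg_sub_neg]
  exact hb.occurs_of_occurs (hlt k) (by lia) (ht k) (ht m) (hc k) (hc m)

theorem iUnion_compactExhaustion_add (n : ℕ) : ⋃ k, W (n + k) = univ :=
  eq_univ_of_forall fun x =>
    have ⟨k, hk⟩ := W.exists_mem x
    mem_iUnion.mpr ⟨k, W.subset (k.le_add_left n) hk⟩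

theorem IsTower.fits (hb : Consistent b) {n : ℕ} {A : ℕ → ℤ} {t : ℕ → LegPath d β}
    (h : IsTower (fun k => W (n + k)) A t) (ht : ∀ k, t k ∈ (b (n + k)).shreds)
    {g : C(ℝ, Space d)} (hg : ∀ k, Occurs (W (n + k)) g (A k) (t k)) : Fits b g := by
  have hV : Monotone fun k => W (n + k) := fun _ _ hkm => W.subset (Nat.add_le_add_left hkm n)
  have hstart := h.tendsto_start hV (iUnion_compactExhaustion_add n)
  have hend := h.tendsto_end hV (iUnion_compactExhaustion_add n)
  refine ⟨g.continuous, fun m => ⟨?_, ?_⟩, fun m a u hu => ?_⟩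
  · refine hstart.frequently ((eventually_ge_atTop m).mono fun k hk => ?_).frequently
    exact notMem_subset (W.subset (by lia)) (hg k).start_notMem
  · refine hend.frequently ((eventually_ge_atTop m).mono fun k hk => ?_).frequently
    exact notMem_subset (W.subset (by lia)) (hg k).end_notMem
  · obtain ⟨k, ⟨hA, hA'⟩, hk⟩ := (((hstart.eventually_le_atBot a).and
      (hend.eventually_ge_atTop (a + u.length))).and (eventually_gt_atTop m)).exists
    exact hb.mem_shreds_of_occurs (by lia) (ht k) ((Occurs.of_eval_iff (hg k).2 hA hA').mpr hu)

theorem Consistent.exists_fits (hb : Consistent b) {n : ℕ} {s : LegPath d β}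
    (hs : s ∈ (b n).shreds)
    (hloops : ∀ N > n, ∀ p ∈ (b N).loops, p.1.2.shreds (W n) {s} = 0) :
    ∃ g : C(ℝ, Space d), Fits b g ∧ Occurs (W n) g 0 s := by
  obtain ⟨A, t, h, ht⟩ := hb.exists_isTower hs hloops
  obtain ⟨g, hg⟩ := h.exists_glue (fun _ _ hkm => W.subset (Nat.add_le_add_left hkm _))
    (iUnion_compactExhaustion_add _)
  refine ⟨g, h.fits hb (fun k => (ht k).1) hg, ?_⟩
  exact ((hg 0).trans (W.subset (by lia)) (ht 0).2).2.2

end Fits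

/-! ### The limit of a consistent sequence -/

section Limit

open Filter

variable {d : ℕ} {β : ℝ} [hβ : Fact (0 < β)] {W : CompactExhaustion (Space d)}
  {b : ∀ n, BoxConfig β (W n)}

/-- The loops that occur in one of the configurations `b n`, and hence in all the later ones:
the loops of the limit configuration. -/
def limitLoops (b : ∀ n, BoxConfig β (W n)) : Set (MarkedLoop d β) := ⋃ n, (b n).loops

/-- The interlacements all of whose shreds belong to the configurations `b n`: the interlacements
of the limit configuration. -/
def limitInterlacements (b : ∀ n, BoxConfig β (W n)) : Set (Interlacement d β) :=
  {γ | ∀ n s, γ.shreds (W n) {s} ≠ 0 → s ∈ (b n).shreds}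

namespace Consistent

variable (hb : Consistent b) {n : ℕ} {s : LegPath d β}

include hb

theorem eventually_mem_loops {p : MarkedLoop d β} (hp : p ∈ limitLoops b) (n : ℕ) :
    ∀ᶠ N in atTop, n < N ∧ p ∈ (b N).loops := by
  obtain ⟨k, hk⟩ := mem_iUnion.mp hp
  exact (eventually_gt_atTop n).and ((eventually_ge_atTop k).mono fun N hN => hb.loops_mono hN hk)

theorem limitLoops_allIn (n : ℕ) : {p ∈ limitLoops b | p.1.2.AllIn (W n)} = (b n).loops := by
  refine subset_antisymm ?_ fun p hp => ⟨mem_iUnion.mpr ⟨n, hp⟩, (b n).allIn p hp⟩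
  rintro p ⟨hp, hpn⟩
  obtain ⟨N, hnN, hpN⟩ := (hb.eventually_mem_loops hp n).exists
  exact (hb.loops_allIn_eq hnN).subset ⟨hpN, hpn⟩

theorem limitLoop_unique {p p' : MarkedLoop d β} (hp : p ∈ limitLoops b)
    (hp' : p' ∈ limitLoops b) (hs : p.1.2.shreds (W n) {s} ≠ 0)
    (hs' : p'.1.2.shreds (W n) {s} ≠ 0) : p = p' := by
  obtain ⟨N, ⟨hnN, hpN⟩, -, hpN'⟩ :=
    ((hb.eventually_mem_loops hp n).and (hb.eventually_mem_loops hp' n)).exists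
  exact hb.loop_unique hnN hpN hpN' hs hs'

theorem mem_shreds_of_limitLoop {p : MarkedLoop d β} (hp : p ∈ limitLoops b)
    (hs : p.1.2.shreds (W n) {s} ≠ 0) : s ∈ (b n).shreds := by
  obtain ⟨N, hnN, hpN⟩ := (hb.eventually_mem_loops hp n).exists
  exact hb.mem_shreds_of_loop hnN hpN hs

theorem limitLoop_shreds_eq_one {p : MarkedLoop d β} (hp : p ∈ limitLoops b)
    (hs : p.1.2.shreds (W n) {s} ≠ 0) : p.1.2.shreds (W n) {s} = 1 := by
  obtain ⟨N, hnN, hpN⟩ := (hb.eventually_mem_loops hp n).exists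
  exact hb.loop_shreds_eq_one hnN hpN hs

theorem finite_limitLoops {A : Set (Space d)} (hA : Bornology.IsBounded A) :
    {p ∈ limitLoops b | p.1.1 ∈ A}.Finite := by
  obtain ⟨m, hm⟩ := W.exists_superset_of_isCompact hA.isCompact_closure
  have hfinite : (⋃ s ∈ (b m).shreds,
      {p ∈ limitLoops b | p.1.2.shreds (W m) {s} ≠ 0}).Finite :=
    (b m).finite_shreds.biUnion fun s _ => Set.Subsingleton.finite fun p hp p' hp' =>
      hb.limitLoop_unique hp.1 hp'.1 hp.2 hp'.2
  refine ((b m).finite_loops.union hfinite).subset ?_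
  rintro p ⟨hp, hpA⟩
  by_cases hallIn : p.1.2.AllIn (W m)
  · exact .inl ((hb.limitLoops_allIn m).subset ⟨hp, hallIn⟩)
  · obtain ⟨s, hs⟩ :=
      MarkedLoop.exists_shreds_singleton_ne_zero (hm (subset_closure hpA)) hallIn
    exact .inr (mem_iUnion₂.mpr ⟨s, hb.mem_shreds_of_limitLoop hp hs, hp, hs⟩)

theorem exists_mem_limitInterlacements (hs : s ∈ (b n).shreds)
    (hloops : ∀ p ∈ limitLoops b, p.1.2.shreds (W n) {s} = 0) :
    ∃ γ ∈ limitInterlacements b, γ.shreds (W n) {s} ≠ 0 := by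
  obtain ⟨g, hg, hgs⟩ := hb.exists_fits hs fun N _ p hp => hloops p (mem_iUnion.mpr ⟨N, hp⟩)
  let γ : Trajectory d β := ⟨g, fun K hK => hg.finite_particles hb hK⟩
  refine ⟨Quotient.mk _ γ, fun m u hu => ?_,
    Interlacement.shreds_singleton_ne_zero_iff.mpr ⟨0, hgs⟩⟩
  obtain ⟨a, ha⟩ := Interlacement.shreds_singleton_ne_zero_iff.mp hu
  exact hg.mem_shreds m a u ha

theorem limitLoop_shreds_eq_zero {γ : Interlacement d β} (hγ : γ ∈ limitInterlacements b)
    (hs : γ.shreds (W n) {s} ≠ 0) {p : MarkedLoop d β} (hp : p ∈ limitLoops b) :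
    p.1.2.shreds (W n) {s} = 0 := by
  obtain ⟨g, rfl⟩ := Quotient.exists_rep γ
  obtain ⟨a, ha⟩ := Interlacement.shreds_singleton_ne_zero_iff.mp hs
  obtain ⟨N, hnN, hpN⟩ := (hb.eventually_mem_loops hp n).exists
  have hg := Trajectory.fits hγ
  obtain ⟨A, t, ht, hst⟩ := ha.exists_parent hg.continuous (W.subset hnN.le) (hg.exits N)
  exact hb.loop_shreds_eq_zero_of_occurs hnN (hg.mem_shreds N A t ht) hst hpN

theorem limitInterlacement_unique {γ γ' : Interlacement d β} (hγ : γ ∈ limitInterlacements b)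
    (hγ' : γ' ∈ limitInterlacements b) (hs : γ.shreds (W n) {s} ≠ 0)
    (hs' : γ'.shreds (W n) {s} ≠ 0) : γ = γ' := by
  obtain ⟨g, rfl⟩ := Quotient.exists_rep γ
  obtain ⟨g', rfl⟩ := Quotient.exists_rep γ'
  obtain ⟨a, ha⟩ := Interlacement.shreds_singleton_ne_zero_iff.mp hs
  obtain ⟨a', ha'⟩ := Interlacement.shreds_singleton_ne_zero_iff.mp hs'
  refine Quotient.sound ⟨a - a', fun t => ?_⟩
  have heq := (Trajectory.fits hγ).eq_of_occurs hb (Trajectory.fits hγ') ha ha' (t - a' * β)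
  rw [sub_add_cancel] at heq
  rw [← heq]
  congr 1
  push_cast
  ring

theorem limitInterlacement_shreds_eq_one {γ : Interlacement d β}
    (hγ : γ ∈ limitInterlacements b) (hs : γ.shreds (W n) {s} ≠ 0) :
    γ.shreds (W n) {s} = 1 := by
  obtain ⟨g, rfl⟩ := Quotient.exists_rep γ
  obtain ⟨a, ha⟩ := Interlacement.shreds_singleton_ne_zero_iff.mp hs
  rw [Interlacement.shreds_singleton, tsum_eq_single a, shredAt_singleton_eq_one ha]
  exact fun a' ha' => shredAt_singleton_eq_zero fun h =>
    ha' ((Trajectory.fits hγ).occurs_unique hb h ha)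

theorem finite_limitInterlacements {K : Set (Space d)} (hK : IsCompact K) :
    {γ ∈ limitInterlacements b | γ.Visits K}.Finite := by
  obtain ⟨m, hm⟩ := W.exists_superset_of_isCompact hK
  have hfinite : (⋃ s ∈ (b m).shreds,
      {γ ∈ limitInterlacements b | γ.shreds (W m) {s} ≠ 0}).Finite :=
    (b m).finite_shreds.biUnion fun s _ => Set.Subsingleton.finite fun γ hγ γ' hγ' =>
      hb.limitInterlacement_unique hγ.1 hγ'.1 hγ.2 hγ'.2
  refine hfinite.subset ?_
  rintro γ ⟨hγ, hγK⟩
  obtain ⟨g, rfl⟩ := Quotient.exists_rep γ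
  obtain ⟨k, hk⟩ : ∃ k : ℤ, g.1 (k * β) ∈ K := hγK
  obtain ⟨a, s, hs, -⟩ := exists_occurs_of_mem g.1.continuous
    ((Trajectory.fits hγ).exits m) (hm hk)
  have hs := Interlacement.shreds_singleton_ne_zero_iff.mpr ⟨a, hs⟩
  exact mem_iUnion₂.mpr ⟨s, hγ m s hs, hγ, hs⟩

theorem tsum_limitLoops_of_ne_zero {p : MarkedLoop d β} (hp : p ∈ limitLoops b)
    (hs : p.1.2.shreds (W n) {s} ≠ 0) :
    ∑' p : limitLoops b, p.1.1.2.shreds (W n) {s} = 1 := by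
  rw [tsum_eq_single (⟨p, hp⟩ : limitLoops b)]
  · exact hb.limitLoop_shreds_eq_one hp hs
  · exact fun p' hne => not_not.mp fun hs' =>
      hne (Subtype.ext (hb.limitLoop_unique p'.2 hp hs' hs))

theorem tsum_limitInterlacements_of_ne_zero {γ : Interlacement d β}
    (hγ : γ ∈ limitInterlacements b) (hs : γ.shreds (W n) {s} ≠ 0) :
    ∑' γ : limitInterlacements b, γ.1.shreds (W n) {s} = 1 := by
  rw [tsum_eq_single (⟨γ, hγ⟩ : limitInterlacements b)]
  · exact hb.limitInterlacement_shreds_eq_one hγ hs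
  · exact fun γ' hne => not_not.mp fun hs' =>
      hne (Subtype.ext (hb.limitInterlacement_unique γ'.2 hγ hs' hs))

theorem limit_multiplicity_eq (n : ℕ) (s : LegPath d β) :
    ∑' p : limitLoops b, p.1.1.2.shreds (W n) {s} +
      ∑' γ : limitInterlacements b, γ.1.shreds (W n) {s} = (b n).shreds.indicator 1 s := by
  by_cases hs : s ∈ (b n).shreds
  · rw [indicator_of_mem hs, Pi.one_apply]
    by_cases! hloop : ∃ p ∈ limitLoops b, p.1.2.shreds (W n) {s} ≠ 0
    · obtain ⟨p, hp, hps⟩ := hloop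
      rw [hb.tsum_limitLoops_of_ne_zero hp hps, ENNReal.tsum_eq_zero.mpr, add_zero]
      exact fun γ => not_not.mp fun hγs => hps (hb.limitLoop_shreds_eq_zero γ.2 hγs hp)
    · obtain ⟨γ, hγ, hγs⟩ := hb.exists_mem_limitInterlacements hs hloop
      rw [hb.tsum_limitInterlacements_of_ne_zero hγ hγs,
        ENNReal.tsum_eq_zero.mpr fun p : limitLoops b => hloop p p.2, zero_add]
  · rw [indicator_of_notMem hs, add_eq_zero, ENNReal.tsum_eq_zero, ENNReal.tsum_eq_zero]
    exact ⟨fun p => not_not.mp fun h => hs (hb.mem_shreds_of_limitLoop p.2 h),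
      fun γ => not_not.mp fun h => hs (γ.2 n s h)⟩

theorem exists_config_proj_eq : ∃ c : Config d β, ∀ n, c.proj (W n) = (b n).toMeasures := by
  refine ⟨⟨limitLoops b, limitInterlacements b, fun A hA => hb.finite_limitLoops hA,
    fun K hK => hb.finite_limitInterlacements hK⟩, fun n => Prod.ext ?_ ?_⟩
  · exact congrArg pointMeasure (hb.limitLoops_allIn n)
  · refine (isDiscrete_cutMeasures_snd _ fun γ => Interlacement.isDiscrete_shreds _).ext
      (isDiscrete_pointMeasure _) fun s => ?_
    refine (cutMeasures_snd_singleton _ _ s).trans ((hb.limit_multiplicity_eq n s).trans ?_)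
    exact (pointMeasure_singleton _ s).symm

end Consistent

end Limit

section Box

variable {d : ℕ}

theorem isClosed_box (R : ℕ+) : IsClosed (box d R) := by
  unfold box
  simp only [ofPred_forall]
  exact isClosed_iInter fun i => isClosed_le (by fun_prop) continuous_const

theorem isCompact_box (R : ℕ+) : IsCompact (box d R) := by
  refine Metric.isCompact_of_isClosed_isBounded (isClosed_box R) ?_
  have hbounded := (PiLp.antilipschitzWith_ofLp 2 fun _ : Fin d => ℝ).isBounded_preimage
    (Metric.isBounded_Icc (fun _ => -(R : ℝ)) fun _ => (R : ℝ))
  exact hbounded.subset fun x hx =>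
    ⟨fun i => (abs_le.mp (hx i)).1, fun i => (abs_le.mp (hx i)).2⟩

theorem box_subset_interior_box {R S : ℕ+} (h : R < S) : box d R ⊆ interior (box d S) := by
  have hopen : IsOpen {x : Space d | ∀ i, |x i| < (S : ℝ)} := by
    simp only [ofPred_forall]
    exact isOpen_iInter_of_finite fun i => isOpen_lt (by fun_prop) continuous_const
  have hsubset : {x : Space d | ∀ i, |x i| < (S : ℝ)} ⊆ box d S := fun x hx i => (hx i).le
  exact Subset.trans (fun x hx i => (hx i).trans_lt (Nat.cast_lt.mpr h))
    (interior_maximal hsubset hopen)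

theorem iUnion_box_succPNat : ⋃ n : ℕ, box d n.succPNat = univ := by
  refine eq_univ_of_forall fun x => ?_
  obtain ⟨n, hn⟩ := exists_nat_ge ‖x‖
  refine mem_iUnion.mpr ⟨n, fun i => ?_⟩
  calc |x i| ≤ ‖x‖ := PiLp.norm_apply_le x i
    _ ≤ n := hn
    _ ≤ (n.succPNat : ℝ) := Nat.cast_le.mpr n.le_succ

/-- The exhaustion of space by the boxes `W_1 ⊆ W_2 ⊆ ⋯`. The indices of an exhaustion start
at `0`, hence the shift. -/
def boxExhaustion (d : ℕ) : CompactExhaustion (Space d) where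
  toFun n := box d n.succPNat
  isCompact' n := isCompact_box n.succPNat
  subset_interior_succ' n := box_subset_interior_box (Nat.lt_succ_self n.succ)
  iUnion_eq' := iUnion_box_succPNat

end Box

theorem Config.measurableSpace_eq_iSup (d : ℕ) (β : ℝ) [Fact (0 < β)] :
    (inferInstance : MeasurableSpace (Config d β)) =
      ⨆ n, MeasurableSpace.comap (Config.proj (boxExhaustion d n)) inferInstance :=
  (Equiv.pnatEquivNat.symm.iSup_comp (g := fun R : ℕ+ =>
    MeasurableSpace.comap (Config.proj (box d R)) inferInstance)).symm

end BoseGas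

end

theorem proposition4p1 (d : ℕ) (β : ℝ) [Fact (0 < β)]
    (ξ : ∀ R : ℕ+, MeasureTheory.Measure (BoseGas.BoxConfig β (BoseGas.box d R)))
    (hprob : ∀ R, MeasureTheory.IsProbabilityMeasure (ξ R))
    (hcons : ∀ R : ℕ+, (ξ (R + 1)).map (BoseGas.BoxConfig.proj (BoseGas.box d R)) =
      (ξ R).map BoseGas.BoxConfig.toMeasures) :
    ∃! P : MeasureTheory.Measure (BoseGas.Config d β),
      MeasureTheory.IsProbabilityMeasure P ∧
        ∀ R : ℕ+, P.map (BoseGas.Config.proj (BoseGas.box d R)) =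
          (ξ R).map BoseGas.BoxConfig.toMeasures := by
  let W := BoseGas.boxExhaustion d
  have hW (n : ℕ) : MeasurableSet (W n) := (W.isCompact n).measurableSet
  have (n : ℕ) : StandardBorelSpace (BoseGas.BoxConfig β (W n)) :=
    BoseGas.BoxConfig.standardBorelSpace (hW n)
  let ξ' (n : ℕ) : Measure (BoseGas.BoxConfig β (W n)) := ξ n.succPNat
  have (n : ℕ) : IsProbabilityMeasure (ξ' n) := hprob _
  refine (existsUnique_congr fun P => and_congr_right fun _ => ?_).mp <|
    BoseGas.existsUnique_measure_of_consistent
      (fun n => BoseGas.BoxConfig.measurableEmbedding_toMeasures (hW n)) ξ'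
      (fun n => hcons n.succPNat)
      (BoseGas.Config.measurableSpace_eq_iSup d β)
      (fun b hb => BoseGas.Consistent.exists_config_proj_eq hb)
      (fun c n b h => BoseGas.Config.proj_eq_proj (W.subset n.le_succ) (W.isCompact (n + 1))
        subset_rfl h)
  exact Equiv.pnatEquivNat.symm.forall_congr_right (q := fun R =>
    P.map (BoseGas.Config.proj (BoseGas.box d R)) = (ξ R).map BoseGas.BoxConfig.toMeasures)
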